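/- **Setting.** Let $K$ be a field of characteristic $0$ (for instance $\mathbb R$ or $\mathbb C$; a real $G$-space may be replaced by its complexification in order to use complex coordinates), $G$ a finite group, and $V$ a finite-dimensional $K$-vector space with a linear $G$-action. Let $A=\mathrm{Poly}(V)$ be the algebra of polynomial functions, $(gf)(x)=f(g^{-1}x)$, and let $A\rtimes G$ be the crossed product, $(aU_g)(bU_h)=a\,g(b)\,U_{gh}$. For $g\in G$ let $V^g$ be the fixed subspace, $N^g=\operatorname{im}(g-1)$ its complement (the sum of the nontrivial irreducible $\langle g\rangle$-representations), $l(g)=\dim N^g$, and let $pr^g:\wedge^\bullet V\to\wedge^{\bullet-l(g)}V^g\otimes\wedge^{l(g)}N^g$ be the projection given by $V=V^g\oplus N^g$. Sections $\Gamma$ have polynomial coefficients. A section $\xi_g$ of $\wedge^{\bullet}TV^g\otimes\wedge^{l(g)}N^g$ over $V^g$ is also regarded as a multivector field on $V$, extended constantly along $N^g$. $C^k(B,M)$ denotes $k$-linear maps $B^k\to M$; multivectors act on $A$ as multidifferential operators by $v_1\wedge\dots\wedge v_a\mapsto\frac1{a!}\sum_\sigma \mathrm{sgn}(\sigma)\,\partial_{v_{\sigma(1)}}\otimes\dots\otimes\partial_{v_{\sigma(a)}}$.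 **Products.** For $\phi\in C^k(B,B)$, $\psi\in C^l(B,B)$ put $$\phi\circ\psi(a_1,\dots,a_{k+l-1})=\sum_{s=1}^{k}(-1)^{(s-1)(l-1)}\phi(a_1,\dots,a_{s-1},\psi(a_s,\dots,a_{s+l-1}),a_{s+l},\dots,a_{k+l-1}).$$ With linear coordinates $x^1,\dots,x^n$ on $V$, the standard pre-Lie product of a $k$-vector field $X$ and an $l$-vector field $Y$ on $V$ is, at $p\in V$, $$(X\circ Y)(p)=\sum_{i_1,\dots,i_{k+l-1}}(X\circ Y)\big(x^{i_1}-x^{i_1}(p),\dots,x^{i_{k+l-1}}-x^{i_{k+l-1}}(p)\big)(p)\ \tfrac{\partial}{\partial x^{i_1}}\wedge\dots\wedge\tfrac{\partial}{\partial x^{i_{k+l-1}}},$$ where on the right $X,Y$ are regarded as cochains in $C^\bullet(A,A)$. **The map $T$.** For each $g$ choose a basis of $N^g$ with coordinates $y^1,\dots,y^{l(g)}$ (for instance coordinates that diagonalize $g$), let $\tilde y^i=g(y^i)$, $\Lambda_g=\frac{\partial}{\partial y^1}\wedge\dots\wedge\frac{\partial}{\partial y^{l(g)}}$, and for $\sigma\in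 S_{l(g)}$ let $z^m_\sigma$ be $(y^1,\dots,y^{l(g)})$ with $y^{\sigma(1)},\dots,y^{\sigma(m)}$ replaced by $\tilde y^{\sigma(1)},\dots,\tilde y^{\sigma(m)}$. With $x$ the $V^g$-component, $$\Omega_g(f_1,\dots,f_{l(g)})=\frac1{l(g)!}\sum_{\sigma}\mathrm{sgn}(\sigma)\frac{\prod_{j=1}^{l(g)}\big(f_j(x,z^{j-1}_\sigma)-f_j(x,z^j_\sigma)\big)}{\prod_{i}(y^i-\tilde y^i)}\in A.$$ For $\xi_g=X_g\otimes\Lambda_g$ of degree $k$ let $T_1^g(\xi_g)(f_1,\dots,f_k)=X_g(f_1,\dots,f_{k-l(g)})\,\Omega_g(f_{k-l(g)+1},\dots,f_k)$. On $C^k(A,A\rtimes G)$ let $(h\Psi)(f_1,\dots,f_k)=U_{h^{-1}}\Psi(hf_1,\dots,hf_k)U_h$. For $\xi=\sum_g\xi_g$ let $T_1(\xi)=\frac1{|G|}\sum_h h\big(\sum_g T_1^g(\xi_g)U_g\big)$ and $T(\xi)=T_2(T_1(\xi))$, where $T_2(\Phi)(a_1U_{g_1},\dots,a_kU_{g_k})=\Phi(a_1,g_1a_2,\dots,g_1\cdots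 g_{k-1}a_k)U_{g_1\cdots g_k}$. Let $T(\xi)_\alpha=T_2(T_1(\xi)_\alpha)$, where $T_1(\xi)_\alpha$ is the part of $T_1(\xi)$ with values in $AU_\alpha$; so $T(\xi)=\sum_\alpha T(\xi)_\alpha$. **The map $L$.** Let $L=L_3L_2L_1$, where $L_1(\Psi)=\frac1{|G|}\sum_g g(\Psi|_A)$, and on the component in $C^m(A,AU_g)\cong C^m(A,A)$ $$L_2^g(\Psi)(p)=\sum_{i_1,\dots,i_m}\frac1{m!}\sum_{\sigma\in S_m}\mathrm{sgn}(\sigma)\Psi\big(x^{i_{\sigma(1)}}-x^{i_{\sigma(1)}}(p),\dots,x^{i_{\sigma(m)}}-x^{i_{\sigma(m)}}(p)\big)(p)\ \tfrac{\partial}{\partial x^{i_1}}\wedge\dots\wedge\tfrac{\partial}{\partial x^{i_m}},\qquad L_3^g(Z)=pr^g(Z|_{V^g}).$$ **Theorem.** Let $$\xi=\sum_\alpha\xi_\alpha\in\Gamma\Big(\bigoplus_{\alpha\in G}\wedge^{k-l(\alpha)}TV^\alpha\otimes\wedge^{l(\alpha)}N^\alpha\Big)^G,\qquad \eta=\sum_\beta\eta_\beta\in\Gamma\Big(\bigoplus_{\beta\in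 G}\wedge^{l-l(\beta)}TV^\beta\otimes\wedge^{l(\beta)}N^\beta\Big)^G .$$ For $\alpha,\beta\in G$ let the contribution of $\xi_\alpha$ and $\eta_\beta$ be the section $c_{\alpha,\beta}=L_3^{\alpha\beta}L_2^{\alpha\beta}\big((T(\xi)_\alpha\circ T(\eta)_\beta)|_A\big)$ over $V^{\alpha\beta}$, formed with the $\alpha\beta$-component. Then: 1. for every $g\in G$, the $g$-component of $L(T(\xi)\circ T(\eta))$ is $\sum_{\alpha\beta=g}c_{\alpha,\beta}$; 2. if $V^\alpha\cap V^\beta=V^{\alpha\beta}$, then $$c_{\alpha,\beta}=pr^{\alpha\beta}\big((\xi_\alpha\circ\eta_\beta)|_{V^{\alpha\beta}}\big),$$ where $\circ$ is the standard pre-Lie product on $V$. -/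

import Mathlib

open Module TensorProduct

noncomputable section

namespace OrbifoldHochschild

/-! ### Polynomial functions on a vector space -/

section Polynomials

variable (K : Type*) [Field K] (V : Type*) [AddCommGroup V] [Module K V]

/-- `Poly(V)`: the algebra of polynomial functions on `V`, i.e. the symmetric algebra of `V*`. -/
abbrev Poly := SymmetricAlgebra K (Dual K V)

variable {V}

/-- A linear function on `V` as an element of `Poly(V)`. -/
abbrev linFun : Dual K V →ₗ[K] Poly K V := SymmetricAlgebra.ι K (Dual K V)

/-- The value of a polynomial function at a point. -/
def evalAt (x : V) : Poly K V →ₐ[K] K := SymmetricAlgebra.lift (Dual.eval K V x)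

@[simp] lemma evalAt_linFun (x : V) (φ : Dual K V) : evalAt K x (linFun K φ) = φ x := by
  simp [evalAt, linFun]

variable {K}
variable {W : Type*} [AddCommGroup W] [Module K W]

/-- Pullback `f ↦ f ∘ T` of polynomial functions along a linear map `T`. -/
def pullback (T : W →ₗ[K] V) : Poly K V →ₐ[K] Poly K W :=
  SymmetricAlgebra.lift (linFun K ∘ₗ T.dualMap)

@[simp] lemma pullback_linFun (T : W →ₗ[K] V) (φ : Dual K V) :
    pullback T (linFun K φ) = linFun K (φ ∘ₗ T) := by
  simp [pullback, linFun]; rfl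

@[simp] lemma evalAt_pullback (T : W →ₗ[K] V) (x : W) (f : Poly K V) :
    evalAt K x (pullback T f) = evalAt K (T x) f := by
  have : (evalAt K x).comp (pullback T) = evalAt K (T x) := by
    apply SymmetricAlgebra.algHom_ext
    ext φ
    have := evalAt_linFun (K := K) x (φ ∘ₗ T)
    have h2 := pullback_linFun T φ
    have h3 := evalAt_linFun (K := K) (T x) φ
    simp only [linFun] at this h2 h3
    simp [h2, this, h3]
  exact DFunLike.congr_fun this f

lemma linFun_ne_zero {φ : Dual K V} (h : φ ≠ 0) : linFun K φ ≠ 0 := by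
  intro h0
  apply h
  ext x
  have := evalAt_linFun (K := K) x φ
  rw [h0] at this
  simpa using this.symm

/-- `f ↦ f + ε ∂_v f`, the first order Taylor expansion of `f` in the direction `v`. -/
def taylor (v : V) : Poly K V →ₐ[K] TrivSqZeroExt (Poly K V) (Poly K V) :=
  SymmetricAlgebra.lift
    { toFun := fun φ =>
        TrivSqZeroExt.inl (linFun K φ) + TrivSqZeroExt.inr (φ v • (1 : Poly K V))
      map_add' := by intro φ ψ; ext <;> simp [add_smul]
      map_smul' := by intro c φ; ext <;> simp [mul_smul] }

lemma taylor_linFun (v : V) (φ : Dual K V) : taylor v (linFun K φ) =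
    TrivSqZeroExt.inl (linFun K φ) + TrivSqZeroExt.inr (φ v • (1 : Poly K V)) := by
  simp [taylor, linFun]

lemma taylor_fst (v : V) (f : Poly K V) : (taylor v f).fst = f := by
  induction f using SymmetricAlgebra.induction with
  | algebraMap r => rw [AlgHom.commutes]; simp [TrivSqZeroExt.algebraMap_eq_inl']
  | ι φ => have := taylor_linFun (K := K) v φ; simp only [linFun] at this; simp [this]
  | mul a b ha hb => simp [ha, hb]
  | add a b ha hb => simp [ha, hb]

/-- The derivative `∂_v f` of a polynomial function in the direction of the constant vector field
`v`; it is linear in `v` and in `f`. -/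
def dirDeriv : V →ₗ[K] Poly K V →ₗ[K] Poly K V :=
  LinearMap.mk₂ K (fun v f => (taylor v f).snd)
    (by
      intro v w f
      induction f using SymmetricAlgebra.induction with
      | algebraMap r => simp [AlgHom.commutes, TrivSqZeroExt.algebraMap_eq_inl']
      | ι φ =>
        have h := fun v => taylor_linFun (K := K) v φ
        simp only [linFun] at h; simp [h, add_smul]
      | mul a b ha hb => simp [ha, hb, taylor_fst]; ring
      | add a b ha hb => simp [ha, hb]; ring)
    (by
      intro c v f
      induction f using SymmetricAlgebra.induction with
      | algebraMap r => simp [AlgHom.commutes, TrivSqZeroExt.algebraMap_eq_inl']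
      | ι φ =>
        have h := fun v => taylor_linFun (K := K) v φ
        simp only [linFun] at h; simp [h, mul_smul]
      | mul a b ha hb => simp [ha, hb, taylor_fst, smul_add]
      | add a b ha hb => simp [ha, hb])
    (by intro v f g; simp)
    (by intro c v f; simp)

@[simp] lemma dirDeriv_linFun (v : V) (φ : Dual K V) :
    dirDeriv v (linFun K φ) = φ v • (1 : Poly K V) := by
  have h := taylor_linFun (K := K) v φ
  simp only [linFun] at h
  simp [dirDeriv, h]

lemma dirDeriv_mul (v : V) (f g : Poly K V) : dirDeriv v (f * g) = f * dirDeriv v g + g * dirDeriv v f := by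
  simp [dirDeriv, taylor_fst, mul_comm]

end Polynomials

/-! ### Hochschild cochains and the Gerstenhaber pre-Lie product -/

section Cochains

variable (K : Type*) [Field K] (B M : Type*) [AddCommGroup B] [Module K B]
  [AddCommGroup M] [Module K M]

/-- `C^k(B, M) = Hom(B^{⊗ k}, M)`. -/
abbrev Cochain (k : ℕ) := MultilinearMap K (fun _ : Fin k => B) M

variable {K B}

/-- The arguments `a₁, …, a_s, ψ(a_{s+1}, …, a_{s+l}), a_{s+l+1}, …, a_{k+l-1}`
(the slot `s` is counted from zero). -/
def insertArgs {k l : ℕ} (ψ : Cochain K B B l) (s : Fin k) (a : Fin (k + l - 1) → B) :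
    Fin k → B := fun j =>
  if h : j.1 < s.1 then a ⟨j.1, by omega⟩
  else if h' : j.1 = s.1 then ψ (fun i => a ⟨s.1 + i.1, by omega⟩)
  else a ⟨j.1 + l - 1, by omega⟩

lemma insertArgs_update {k l : ℕ} (ψ : Cochain K B B l) (s : Fin k) (i : Fin (k + l - 1)) :
    ∃ j : Fin k, ∀ a : Fin (k + l - 1) → B, ∃ F : B →ₗ[K] B, ∀ x : B,
      insertArgs ψ s (Function.update a i x) = Function.update (insertArgs ψ s a) j (F x) := by
  rcases lt_or_ge i.1 s.1 with h1 | h1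
  · refine ⟨⟨i.1, by omega⟩, fun a => ⟨LinearMap.id, fun x => ?_⟩⟩
    funext j
    by_cases hj : j.1 = i.1
    · have : j = ⟨i.1, by omega⟩ := Fin.ext hj
      rw [← this, Function.update_self]
      have a1 : j.1 < s.1 := by omega
      have e1 : (⟨j.1, by omega⟩ : Fin (k + l - 1)) = i := Fin.ext hj
      simp only [insertArgs, a1, dite_true, e1, Function.update_self, LinearMap.id_apply]
    · have hj' : j ≠ ⟨i.1, by omega⟩ := fun h => hj (by simp [h])
      rw [Function.update_of_ne hj']
      simp only [insertArgs]
      split_ifs with h2 h3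
      · rw [Function.update_of_ne]; intro h; exact hj (by simp [← h])
      · congr 1; funext t; rw [Function.update_of_ne]
        intro h; have := congrArg Fin.val h; simp at this; omega
      · rw [Function.update_of_ne]
        intro h; have := congrArg Fin.val h; simp at this; omega
  · rcases lt_or_ge i.1 (s.1 + l) with h4 | h4
    · refine ⟨s, fun a => ⟨ψ.toLinearMap (fun t => a ⟨s.1 + t.1, by omega⟩)
        ⟨i.1 - s.1, by omega⟩, fun x => ?_⟩⟩
      funext j
      by_cases hj : j = s
      · subst hj
        simp only [insertArgs, lt_irrefl, dite_false, dite_true, Function.update_self,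
          MultilinearMap.toLinearMap_apply]
        congr 1
        funext t
        by_cases ht : t.1 = i.1 - j.1
        · have e1 : (⟨j.1 + t.1, by omega⟩ : Fin (k + l - 1)) = i := Fin.ext (by simp; omega)
          have e2 : t = ⟨i.1 - j.1, by omega⟩ := Fin.ext ht
          rw [e1, e2]; simp
        · rw [Function.update_of_ne, Function.update_of_ne]
          · intro h; exact ht (by simp [h])
          · intro h; have := congrArg Fin.val h; simp at this; omega
      · have hj' : j.1 ≠ s.1 := fun h => hj (Fin.ext h)
        rw [Function.update_of_ne hj]
        simp only [insertArgs, hj', dite_false]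
        split_ifs with h2
        · rw [Function.update_of_ne]
          intro h; have := congrArg Fin.val h; simp at this; omega
        · rw [Function.update_of_ne]
          intro h; have := congrArg Fin.val h; simp at this; omega
    · refine ⟨⟨i.1 + 1 - l, by omega⟩, fun a => ⟨LinearMap.id, fun x => ?_⟩⟩
      funext j
      by_cases hj : j.1 = i.1 + 1 - l
      · have : j = ⟨i.1 + 1 - l, by omega⟩ := Fin.ext hj
        rw [← this, Function.update_self]
        have a1 : ¬ j.1 < s.1 := by omega
        have a2 : ¬ j.1 = s.1 := by omega
        have e1 : (⟨j.1 + l - 1, by omega⟩ : Fin (k + l - 1)) = i := Fin.ext (by simp; omega)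
        simp only [insertArgs, a1, a2, dite_false, e1, Function.update_self, LinearMap.id_apply]
      · have hj' : j ≠ ⟨i.1 + 1 - l, by omega⟩ := fun h => hj (by simp [h])
        rw [Function.update_of_ne hj']
        simp only [insertArgs]
        split_ifs with h2 h3
        · rw [Function.update_of_ne]
          intro h; have := congrArg Fin.val h; simp at this; omega
        · congr 1; funext t; rw [Function.update_of_ne]
          intro h; have := congrArg Fin.val h; simp at this; omega
        · rw [Function.update_of_ne]
          intro h; have := congrArg Fin.val h; simp at this; omega

/-- `φ(a₁, …, a_s, ψ(a_{s+1}, …, a_{s+l}), a_{s+l+1}, …, a_{k+l-1})` as a cochain. -/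
def insertion {k l : ℕ} (φ : Cochain K B B k) (ψ : Cochain K B B l) (s : Fin k) :
    Cochain K B B (k + l - 1) where
  toFun a := φ (insertArgs ψ s a)
  map_update_add' := by
    intro inst a i x y
    obtain rfl : inst = instDecidableEqFin _ := Subsingleton.elim _ _
    obtain ⟨j, hj⟩ := insertArgs_update ψ s i
    obtain ⟨F, hF⟩ := hj a
    rw [hF, hF, hF, map_add, φ.map_update_add]
  map_update_smul' := by
    intro inst a i c x
    obtain rfl : inst = instDecidableEqFin _ := Subsingleton.elim _ _
    obtain ⟨j, hj⟩ := insertArgs_update ψ s i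
    obtain ⟨F, hF⟩ := hj a
    rw [hF, hF, map_smul, φ.map_update_smul]

/-- The pre-Lie product `φ ∘ ψ` on `C^•(B, B)` whose commutator is the Gerstenhaber bracket,
`(φ ∘ ψ)(a₁, …, a_{k+l-1}) =
  ∑_{i=1}^k (-1)^{(i-1)(l-1)} φ(a₁, …, a_{i-1}, ψ(a_i, …, a_{i+l-1}), a_{i+l}, …, a_{k+l-1})`.
With `s = i - 1` the sign is written as `(-1)^{s(l+1)}`, so that no subtraction is needed. -/
def gerst {k l : ℕ} (φ : Cochain K B B k) (ψ : Cochain K B B l) : Cochain K B B (k + l - 1) :=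
  ∑ s : Fin k, (-1 : K) ^ (s.1 * (l + 1)) • insertion φ ψ s

end Cochains

/-! ### Multivector fields on a vector space -/

section MultivectorFields

variable {K : Type*} [Field K] {V : Type*} [AddCommGroup V] [Module K V]

variable (K V) in
/-- Polynomial multivector fields on `V`: the sections `Poly(V) ⊗ ∧^• V` of `∧^• TV`. -/
abbrev MVField := Poly K V ⊗[K] ExteriorAlgebra K V

/-- The value at a point `x` of a multivector field, an element of `∧^• V`. -/
def mvEval (x : V) : MVField K V →ₗ[K] ExteriorAlgebra K V :=
  (TensorProduct.lid K _).toLinearMap ∘ₗ LinearMap.rTensor _ (evalAt K x).toLinearMap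

@[simp] lemma mvEval_tmul (x : V) (c : Poly K V) (w : ExteriorAlgebra K V) :
    mvEval x (c ⊗ₜ[K] w) = evalAt K x c • w := by
  simp [mvEval]

/-- A constant `a`-vector as a multidifferential operator on `Poly(V)`:
`v₁ ∧ ⋯ ∧ v_a` acts by `(f₁, …, f_a) ↦ (1/a!) ∑_σ sgn(σ) (∂_{v_{σ(1)}} f₁) ⋯ (∂_{v_{σ(a)}} f_a)`;
the components of other degrees act by zero. -/
def constOp (a : ℕ) : ExteriorAlgebra K V →ₗ[K] Cochain K (Poly K V) (Poly K V) a :=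
  ExteriorAlgebra.liftAlternating (Pi.single a
    ((a.factorial : K)⁻¹ • MultilinearMap.alternatization
      ((MultilinearMap.piLinearMap (MultilinearMap.mkPiAlgebra K (Fin a) (Poly K V))).compLinearMap
        (fun _ => dirDeriv))))

lemma constOp_ιMulti (a : ℕ) (v : Fin a → V) (f : Fin a → Poly K V) :
    constOp a (ExteriorAlgebra.ιMulti K a v) f =
      (a.factorial : K)⁻¹ • ∑ σ : Equiv.Perm (Fin a),
        (Equiv.Perm.sign σ : ℤ) • ∏ j, dirDeriv (v (σ j)) (f j) := by
  rw [constOp, ExteriorAlgebra.liftAlternating_apply_ιMulti, Pi.single_eq_same]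
  simp [MultilinearMap.alternatization_apply, Units.smul_def]

/-- The degree `a` component of a multivector field `∑ c ⊗ w` as a multidifferential operator
`(f₁, …, f_a) ↦ ∑ c · w(f₁, …, f_a)` on `Poly(V)`. -/
def mvOp (a : ℕ) : MVField K V →ₗ[K] Cochain K (Poly K V) (Poly K V) a :=
  TensorProduct.lift (LinearMap.mk₂ K
    (fun c w => (LinearMap.mulLeft K c).compMultilinearMap (constOp a w))
    (by intros; ext; simp [add_mul])
    (by intros; ext; simp)
    (by intros; ext; simp)
    (by intros; ext; simp))

@[simp] lemma mvOp_tmul (a : ℕ) (c : Poly K V) (w : ExteriorAlgebra K V) (f : Fin a → Poly K V) :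
    mvOp a (c ⊗ₜ[K] w) f = c * constOp a w f := by
  simp [mvOp]

variable {n : ℕ} (b : Basis (Fin n) K V)

/-- The function `x^i - x^i(p)`, where `x¹, …, xⁿ` are the linear coordinates of the basis `b`. -/
def shiftedCoord (p : V) (i : Fin n) : Poly K V :=
  linFun K (b.coord i) - algebraMap K (Poly K V) (b.coord i p)

/-- `∂/∂x^{i₁} ∧ ⋯ ∧ ∂/∂x^{i_m}`. -/
def coordVector {m : ℕ} (I : Fin m → Fin n) : ExteriorAlgebra K V :=
  ExteriorAlgebra.ιMulti K m (fun j => b (I j))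

/-- The standard pre-Lie product of a `k`-vector field `X` and an `l`-vector field `Y`,
evaluated at the point `p`:
`∑_{i₁, …, i_{k+l-1}} ∑_s (-1)^{(s-1)(l-1)} X((x₁-p)^{i₁}, …, Y((x_s-p)^{i_s}, …), …)(p)
  ∂/∂x^{i₁} ∧ ⋯ ∧ ∂/∂x^{i_{k+l-1}}`,
where `X` and `Y` act as multidifferential operators. -/
def preLie (k l : ℕ) (X Y : MVField K V) (p : V) : ExteriorAlgebra K V :=
  ∑ I : Fin (k + l - 1) → Fin n,
    evalAt K p (gerst (mvOp k X) (mvOp l Y) (fun j => shiftedCoord b p (I j))) • coordVector b I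

/-- The map `L₂^g` from cochains to multivector fields, evaluated at the point `p`:
`∑_{i₁, …, i_m} (1/m!) ∑_σ sgn(σ) Ψ((x_{σ(1)}-p)^{i₁} ⋯ (x_{σ(m)}-p)^{i_m})(p)
  ∂/∂x^{i₁} ∧ ⋯ ∧ ∂/∂x^{i_m}`. -/
def L2 {m : ℕ} (Ψ : Cochain K (Poly K V) (Poly K V) m) (p : V) : ExteriorAlgebra K V :=
  ∑ I : Fin m → Fin n, ((m.factorial : K)⁻¹ * ∑ σ : Equiv.Perm (Fin m),
    (Equiv.Perm.sign σ : ℤ) • evalAt K p (Ψ (fun j => shiftedCoord b p (I (σ j))))) •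
      coordVector b I

end MultivectorFields

/-! ### Linear actions of a finite group -/

section Action

variable (K : Type*) [Field K] {G : Type*} [Group G]
  (V : Type*) [AddCommGroup V] [Module K V] [DistribMulAction G V] [SMulCommClass G K V]

/-- The action of `g` on `V` as a linear map. -/
abbrev actV (g : G) : V →ₗ[K] V := DistribSMul.toLinearMap K V g

/-- `V^g`, the subspace of vectors fixed by `g`. -/
def fixedSpace (g : G) : Submodule K V := LinearMap.ker (actV K V g - LinearMap.id)

/-- `N^g`, the sum of all nontrivial irreducible subrepresentations of the cyclic group generated
by `g`; since `1 - g` is invertible on each of these and zero on `V^g`, it is the image of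
`g - 1`. -/
def normalSpace (g : G) : Submodule K V := LinearMap.range (actV K V g - LinearMap.id)

/-- `l(g) = dim N^g`. -/
def codim (g : G) : ℕ := finrank K (normalSpace K V g)

variable {V}

@[simp] lemma mem_fixedSpace {g : G} {v : V} : v ∈ fixedSpace K V g ↔ g • v = v := by
  simp [fixedSpace, sub_eq_zero]

lemma smul_mem_fixedSpace {g : G} (h : G) {v : V} (hv : v ∈ fixedSpace K V g) :
    h • v ∈ fixedSpace K V (h * g * h⁻¹) := by
  rw [mem_fixedSpace] at *
  rw [mul_smul, mul_smul, inv_smul_smul, hv]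

variable (V)

theorem isCompl_fixed_normal [CharZero K] [Finite G] [FiniteDimensional K V] (g : G) :
    IsCompl (fixedSpace K V g) (normalSpace K V g) := by
  have hd : finrank K (fixedSpace K V g) + finrank K (normalSpace K V g) = finrank K V := by
    rw [add_comm]; exact LinearMap.finrank_range_add_finrank_ker _
  rw [Submodule.isCompl_iff_disjoint _ _ (le_of_eq hd.symm), Submodule.disjoint_def]
  rintro w hw ⟨v, hv⟩
  rw [mem_fixedSpace] at hw
  have hv' : w = g • v - v := by simpa using hv.symm
  have hpow : ∀ i : ℕ, g ^ i • w = w := by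
    intro i
    induction i with
    | zero => simp
    | succ i ih => rw [pow_succ, mul_smul, hw, ih]
  have h1 : ∑ i ∈ Finset.range (orderOf g), g ^ i • w = 0 := by
    have : ∀ i ∈ Finset.range (orderOf g), g ^ i • w = g ^ (i + 1) • v - g ^ i • v := by
      intro i _
      rw [hv', smul_sub, ← mul_smul, ← pow_succ]
    rw [Finset.sum_congr rfl this, Finset.sum_range_sub (fun i => g ^ i • v)]
    simp [pow_orderOf_eq_one]
  simp only [hpow, Finset.sum_const, Finset.card_range] at h1
  have h2 : ((orderOf g : K)) • w = 0 := by rw [Nat.cast_smul_eq_nsmul]; exact h1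
  rcases smul_eq_zero.1 h2 with h3 | h3
  · exact absurd (by exact_mod_cast h3) (orderOf_pos g).ne'
  · exact h3

variable [CharZero K] [Finite G] [FiniteDimensional K V]

/-- The projection `V = V^g ⊕ N^g → V^g`. -/
def projFixed (g : G) : V →ₗ[K] fixedSpace K V g :=
  Submodule.projectionOnto _ _ (isCompl_fixed_normal K V g)

/-- The projection `V = V^g ⊕ N^g → N^g`. -/
def projNormal (g : G) : V →ₗ[K] normalSpace K V g :=
  Submodule.projectionOnto _ _ (isCompl_fixed_normal K V g).symm

/-- The grading of `∧^• V = ∧^• V^g ⊗ ∧^• N^g` by the degree in `N^g`, recorded by the exponent of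
a central variable `t`: the algebra homomorphism with `v ↦ p(v) + t q(v)`, where `p` and `q` are the
projections onto `V^g` and `N^g`. -/
def normalGrading (g : G) : ExteriorAlgebra K V →ₐ[K] Polynomial (ExteriorAlgebra K V) :=
  ExteriorAlgebra.lift K
    ⟨((Polynomial.monomial 0).restrictScalars K ∘ₗ ExteriorAlgebra.ι K ∘ₗ
        (fixedSpace K V g).subtype ∘ₗ projFixed K V g) +
      ((Polynomial.monomial 1).restrictScalars K ∘ₗ ExteriorAlgebra.ι K ∘ₗ
        (normalSpace K V g).subtype ∘ₗ projNormal K V g), by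
      intro v
      simp only [LinearMap.add_apply, LinearMap.comp_apply, LinearMap.coe_restrictScalars,
        Submodule.subtype_apply, add_mul, mul_add, Polynomial.monomial_mul_monomial,
        ExteriorAlgebra.ι_sq_zero, map_zero, zero_add, add_zero]
      rw [← map_add, ExteriorAlgebra.ι_add_mul_swap, map_zero]⟩

/-- `pr^g`, the projection of `∧^• V = ⊕_{a, c} ∧^a V^g ⊗ ∧^c N^g` onto
`⊕_a ∧^a V^g ⊗ ∧^{l(g)} N^g`. -/
def pr (g : G) : ExteriorAlgebra K V →ₗ[K] ExteriorAlgebra K V :=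
  (Polynomial.lcoeff (ExteriorAlgebra K V) (codim K V g)).restrictScalars K ∘ₗ
    (normalGrading K V g).toLinearMap

end Action

/-! ### The action on polynomial functions and the crossed product -/

section CrossedProduct

variable (K : Type*) [Field K] {G : Type*} [Group G]
  (V : Type*) [AddCommGroup V] [Module K V] [DistribMulAction G V] [SMulCommClass G K V]

/-- The action `(g f)(x) = f(g⁻¹ x)` of `G` on `Poly(V)`. -/
instance polyAction : MulSemiringAction G (Poly K V) where
  smul g f := pullback (actV K V g⁻¹) f
  one_smul f := by
    change pullback (actV K V (1 : G)⁻¹) f = f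
    have : pullback (actV K V (1 : G)⁻¹) = AlgHom.id K (Poly K V) := by
      apply SymmetricAlgebra.algHom_ext
      refine LinearMap.ext fun φ => ?_
      refine (pullback_linFun (actV K V (1 : G)⁻¹) φ).trans ?_
      exact congrArg (linFun K) (LinearMap.ext fun v => by simp)
    rw [this]; rfl
  mul_smul g h f := by
    change pullback (actV K V (g * h)⁻¹) f =
      pullback (actV K V g⁻¹) (pullback (actV K V h⁻¹) f)
    have : pullback (actV K V (g * h)⁻¹) =
        (pullback (actV K V g⁻¹)).comp (pullback (actV K V h⁻¹)) := by
      apply SymmetricAlgebra.algHom_ext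
      refine LinearMap.ext fun φ => ?_
      refine (pullback_linFun (actV K V (g * h)⁻¹) φ).trans ?_
      have h1 := pullback_linFun (actV K V h⁻¹) φ
      have h2 := pullback_linFun (actV K V g⁻¹) (φ ∘ₗ actV K V h⁻¹)
      simp only [linFun] at h1 h2
      refine Eq.trans ?_ ((congrArg (pullback (actV K V g⁻¹)) h1).trans h2).symm
      exact congrArg (linFun K) (LinearMap.ext fun v => by simp [mul_smul])
    rw [this]; rfl
  smul_zero g := map_zero _
  smul_add g := map_add _
  smul_one g := map_one _
  smul_mul g := map_mul _

variable {V} in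
lemma smul_poly_def (g : G) (f : Poly K V) : g • f = pullback (actV K V g⁻¹) f := rfl

instance : SMulCommClass G K (Poly K V) where
  smul_comm g c f := map_smul (pullback (actV K V g⁻¹)) c f

variable (G) in
/-- The crossed product `Poly(V) ⋊ G`, with `(a U_g)(b U_h) = a g(b) U_{gh}`; the element `a U_g`
is `SkewMonoidAlgebra.single g a`. -/
abbrev Crossed := SkewMonoidAlgebra (Poly K V) G

/-- The element `U_g`. -/
def unitary (g : G) : Crossed K G V := SkewMonoidAlgebra.single g 1

/-- The map `c ↦ u c`. -/
def leftMul (u : Crossed K G V) : Crossed K G V →ₗ[K] Crossed K G V where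
  toFun c := u * c
  map_add' := mul_add u
  map_smul' r c := Algebra.mul_smul_comm r u c

/-- The map `c ↦ c u`. -/
def rightMul (u : Crossed K G V) : Crossed K G V →ₗ[K] Crossed K G V where
  toFun c := c * u
  map_add' c d := add_mul c d u
  map_smul' r c := Algebra.smul_mul_assoc r c u

/-- The coefficient of `U_g`. -/
def coeffAt (g : G) : Crossed K G V →ₗ[K] Poly K V :=
  Finsupp.lapply g ∘ₗ SkewMonoidAlgebra.coeffLinearEquiv.toLinearMap

/-- The map `a ↦ a U_g`. -/
def inclAt (g : G) : Poly K V →ₗ[K] Crossed K G V := SkewMonoidAlgebra.lsingle K g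

variable {V}

/-- The operation `(gΨ)(a₁, …, a_k) = U_{g⁻¹} Ψ(g a₁, …, g a_k) U_g` on
`C^k(Poly(V), Poly(V) ⋊ G)`. -/
def conjCochain (g : G) {k : ℕ} (Ψ : Cochain K (Poly K V) (Crossed K G V) k) :
    Cochain K (Poly K V) (Crossed K G V) k :=
  (leftMul K V (unitary K V g⁻¹) ∘ₗ rightMul K V (unitary K V g)).compMultilinearMap
      (Ψ.compLinearMap fun _ => DistribSMul.toLinearMap K (Poly K V) g)

/-- The average `|G|⁻¹ ∑_g gΨ`. -/
def average [Fintype G] {k : ℕ} (Ψ : Cochain K (Poly K V) (Crossed K G V) k) :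
    Cochain K (Poly K V) (Crossed K G V) k :=
  (Fintype.card G : K)⁻¹ • ∑ g : G, conjCochain K g Ψ

/-- The restriction of a cochain on `Poly(V) ⋊ G` to `Poly(V)`. -/
def restrictPoly {k : ℕ} (Ψ : Cochain K (Crossed K G V) (Crossed K G V) k) :
    Cochain K (Poly K V) (Crossed K G V) k :=
  Ψ.compLinearMap fun _ => inclAt K V 1

/-- The map `L₁`. -/
def L1 [Fintype G] {k : ℕ} (Ψ : Cochain K (Crossed K G V) (Crossed K G V) k) :
    Cochain K (Poly K V) (Crossed K G V) k :=
  average K (restrictPoly K Ψ)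

/-- The `g`-component of a cochain with values in `Poly(V) ⋊ G = ⊕_g Poly(V)_g`. -/
def component (g : G) {k : ℕ} (Ψ : Cochain K (Poly K V) (Crossed K G V) k) :
    Cochain K (Poly K V) (Poly K V) k :=
  (coeffAt K V g).compMultilinearMap Ψ

/-- The cochain `Φ U_g` with values in the summand `Poly(V)_g` of `Poly(V) ⋊ G`. -/
def ofComponent (g : G) {k : ℕ} (Φ : Cochain K (Poly K V) (Poly K V) k) :
    Cochain K (Poly K V) (Crossed K G V) k :=
  (inclAt K V g).compMultilinearMap Φ

/-- The map `T₂`, the multilinear extension of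
`T₂(Φ)(a₁ U_{g₁}, …, a_k U_{g_k}) = Φ(a₁, g₁ a₂, …, g₁ ⋯ g_{k-1} a_k) U_{g₁ ⋯ g_k}`. -/
def T2 [Fintype G] {k : ℕ} (Φ : Cochain K (Poly K V) (Crossed K G V) k) :
    Cochain K (Crossed K G V) (Crossed K G V) k :=
  ∑ γ : Fin k → G,
    (rightMul K V (unitary K V (Fin.partialProd γ (Fin.last k)))).compMultilinearMap
      (Φ.compLinearMap fun i =>
        DistribSMul.toLinearMap K (Poly K V) (Fin.partialProd γ i.castSucc) ∘ₗ coeffAt K V (γ i))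

lemma T2_single [Fintype G] {k : ℕ} (Φ : Cochain K (Poly K V) (Crossed K G V) k)
    (a : Fin k → Poly K V) (γ : Fin k → G) :
    T2 K Φ (fun i => SkewMonoidAlgebra.single (γ i) (a i)) =
      Φ (fun i => Fin.partialProd γ i.castSucc • a i) *
        unitary K V (Fin.partialProd γ (Fin.last k)) := by
  classical
  simp only [T2, sum_apply]
  rw [Finset.sum_eq_single γ]
  · simp [coeffAt, rightMul, SkewMonoidAlgebra.coeffLinearEquiv]
  · intro δ _ hδ
    obtain ⟨i, hi⟩ := Function.ne_iff.1 hδ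
    simp only [LinearMap.compMultilinearMap_apply, MultilinearMap.compLinearMap_apply]
    rw [Φ.map_coord_zero i, map_zero]
    simp [coeffAt, SkewMonoidAlgebra.coeffLinearEquiv, Finsupp.single_eq_of_ne hi]
  · simp

end CrossedProduct

/-! ### The twisted cocycles `Ω_g` -/

section TwistedCocycle

lemma linFun_dvd_pullback_sub {K : Type*} [Field K] {V : Type*} [AddCommGroup V] [Module K V]
    (S T : V →ₗ[K] V) (φ : Dual K V) (v : V) (h : S - T = φ.smulRight v) (f : Poly K V) :
    linFun K φ ∣ pullback S f - pullback T f := by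
  induction f using SymmetricAlgebra.induction with
  | algebraMap r => simp [AlgHom.commutes]
  | ι ψ =>
    have h1 := pullback_linFun S ψ
    have h2 := pullback_linFun T ψ
    simp only [linFun] at h1 h2
    rw [h1, h2, ← map_sub, ← LinearMap.comp_sub, h]
    have : ψ ∘ₗ φ.smulRight v = ψ v • φ := by ext x; simp [mul_comm]
    rw [this, map_smul]
    exact ⟨ψ v • 1, by simp⟩
  | mul a b ha hb =>
    have : pullback S (a * b) - pullback T (a * b) =
      pullback S a * (pullback S b - pullback T b) +
        (pullback S a - pullback T a) * pullback T b := by simp only [map_mul]; ring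
    rw [this]
    exact dvd_add (hb.mul_left _) (ha.mul_right _)
  | add a b ha hb =>
    have : pullback S (a + b) - pullback T (a + b) =
      (pullback S a - pullback T a) + (pullback S b - pullback T b) := by
        simp only [map_add]; ring
    rw [this]
    exact dvd_add ha hb

/-- The quotient `F / d` of a linear map `F` with values in `Poly(V)` that are divisible by
`d ≠ 0`. -/
def exactDiv {K : Type*} [Field K] {V : Type*} [AddCommGroup V] [Module K V]
    {B : Type*} [AddCommGroup B] [Module K B] (d : Poly K V) (hd : d ≠ 0)
    (F : B →ₗ[K] Poly K V) (h : ∀ x, d ∣ F x) : B →ₗ[K] Poly K V where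
  toFun x := (h x).choose
  map_add' x y := by
    apply mul_left_cancel₀ hd
    rw [mul_add, ← (h x).choose_spec, ← (h y).choose_spec, ← (h (x + y)).choose_spec, map_add]
  map_smul' c x := by
    apply mul_left_cancel₀ hd
    rw [RingHom.id_apply, mul_smul_comm, ← (h x).choose_spec, ← (h (c • x)).choose_spec, map_smul]

lemma mul_exactDiv {K : Type*} [Field K] {V : Type*} [AddCommGroup V] [Module K V]
    {B : Type*} [AddCommGroup B] [Module K B] (d : Poly K V) (hd : d ≠ 0)
    (F : B →ₗ[K] Poly K V) (h : ∀ x, d ∣ F x) (x : B) : d * exactDiv d hd F h x = F x :=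
  (h x).choose_spec.symm

variable {K : Type*} [Field K] [CharZero K] {G : Type*} [Group G] [Finite G]
  {V : Type*} [AddCommGroup V] [Module K V] [FiniteDimensional K V]
  [DistribMulAction G V] [SMulCommClass G K V]

variable {g : G} (e : Basis (Fin (codim K V g)) K (normalSpace K V g))

/-- The coordinate `y^i` of `N^g` with respect to the basis `e`, as a linear function on
`V = V^g ⊕ N^g`. -/
def normalCoord (i : Fin (codim K V g)) : Dual K V := e.coord i ∘ₗ projNormal K V g

/-- The function `ỹ^i = g(y^i)`. -/
def movedCoord (i : Fin (codim K V g)) : Dual K V := normalCoord e i ∘ₗ actV K V g⁻¹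

/-- The point `(x, z^m_σ)` as a function of the point `(x, y)`: it has the coordinates
`ỹ^{σ(1)}, …, ỹ^{σ(m)}` in place of `y^{σ(1)}, …, y^{σ(m)}`. -/
def zPoint (σ : Equiv.Perm (Fin (codim K V g))) (m : ℕ) : V →ₗ[K] V :=
  (fixedSpace K V g).subtype ∘ₗ projFixed K V g +
    ∑ i, (if (σ.symm i).1 < m then movedCoord e i else normalCoord e i).smulRight (e i : V)

/-- The function `y^i - ỹ^i`. -/
def denom (i : Fin (codim K V g)) : Poly K V := linFun K (normalCoord e i - movedCoord e i)

lemma denom_ne_zero (i : Fin (codim K V g)) : denom e i ≠ 0 := by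
  apply linFun_ne_zero
  intro h
  obtain ⟨w, hw⟩ := (e i).2
  have h1 : normalCoord e i (g • w) = normalCoord e i w := by
    have := LinearMap.congr_fun (sub_eq_zero.1 h) (g • w)
    simpa [movedCoord] using this
  have h2 : normalCoord e i (e i : V) = 1 := by
    simp [normalCoord, projNormal]
  rw [← hw] at h2
  simp [h1] at h2

lemma zPoint_sub (σ : Equiv.Perm (Fin (codim K V g))) (j : Fin (codim K V g)) :
    zPoint e σ j.1 - zPoint e σ (j.1 + 1) =
      (normalCoord e (σ j) - movedCoord e (σ j)).smulRight (e (σ j) : V) := by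
  rw [zPoint, zPoint, add_sub_add_left_eq_sub, ← Finset.sum_sub_distrib,
    Finset.sum_eq_single (σ j)]
  · ext v; simp [sub_smul]
  · intro i _ hi
    have : (σ.symm i).1 ≠ j.1 := by
      intro h
      exact hi (by rw [← Fin.ext h]; simp)
    by_cases h : (σ.symm i).1 < j.1
    · simp [h, Nat.lt_succ_of_lt h]
    · have h' : ¬ (σ.symm i).1 < j.1 + 1 := by omega
      simp [h, h']
  · simp

/-- The difference quotient
`f ↦ (f(x, z^{j-1}_σ) - f(x, z^j_σ)) / (y^{σ(j)} - ỹ^{σ(j)})` (`j` is counted from zero in the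
code). -/
def diffQuot (σ : Equiv.Perm (Fin (codim K V g))) (j : Fin (codim K V g)) :
    Poly K V →ₗ[K] Poly K V :=
  exactDiv (denom e (σ j)) (denom_ne_zero e (σ j))
    ((pullback (zPoint e σ j.1)).toLinearMap - (pullback (zPoint e σ (j.1 + 1))).toLinearMap)
    (fun f => linFun_dvd_pullback_sub _ _ _ _ (zPoint_sub e σ j) f)

/-- The twisted cocycle `Ω_g`; see `twistedCocycle_mul` for its formula as a single fraction. -/
def twistedCocycle : Cochain K (Poly K V) (Poly K V) (codim K V g) :=
  ((codim K V g).factorial : K)⁻¹ • ∑ σ : Equiv.Perm (Fin (codim K V g)),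
    (Equiv.Perm.sign σ : ℤ) •
      (MultilinearMap.mkPiAlgebra K (Fin (codim K V g)) (Poly K V)).compLinearMap
        (fun j => diffQuot e σ j)

/-- `Ω_g(f₁, …, f_l) = (1/l!) ∑_σ sgn(σ) ∏_j (f_j(x, z^{j-1}_σ) - f_j(x, z^j_σ)) /
  ((y¹ - ỹ¹) ⋯ (y^l - ỹ^l))`. -/
theorem twistedCocycle_mul (f : Fin (codim K V g) → Poly K V) :
    (∏ i, denom e i) * twistedCocycle e f =
      ((codim K V g).factorial : K)⁻¹ • ∑ σ : Equiv.Perm (Fin (codim K V g)),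
        (Equiv.Perm.sign σ : ℤ) •
          ∏ j, (pullback (zPoint e σ j.1) (f j) - pullback (zPoint e σ (j.1 + 1)) (f j)) := by
  simp only [twistedCocycle, smul_apply, sum_apply, mul_smul_comm,
    Finset.mul_sum]
  congr 1
  refine Finset.sum_congr rfl fun σ _ => ?_
  congr 1
  rw [MultilinearMap.compLinearMap_apply, MultilinearMap.mkPiAlgebra_apply,
    ← Equiv.prod_comp σ (fun i => denom e i), ← Finset.prod_mul_distrib]
  refine Finset.prod_congr rfl fun j _ => ?_
  exact mul_exactDiv _ _ _ _ _

end TwistedCocycle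

/-! ### Twisted multivector fields and the maps `T` and `L` -/

section TwistedFields

variable (K : Type*) [Field K] {G : Type*} [Group G]
  (V : Type*) [AddCommGroup V] [Module K V] [DistribMulAction G V] [SMulCommClass G K V]

/-- The sections `Poly(V^g) ⊗ ∧^• V^g ⊗ ∧^• N^g` of `∧^• TV^g ⊗ ∧^• N^g` over `V^g`. -/
abbrev TwistedField (g : G) :=
  Poly K (fixedSpace K V g) ⊗[K]
    (ExteriorAlgebra K (fixedSpace K V g) ⊗[K] ExteriorAlgebra K (normalSpace K V g))

/-- The sections of `∧^{k - l(g)} TV^g ⊗ ∧^{l(g)} N^g` (which is zero if `k < l(g)`). -/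
def twistedFields (g : G) (k : ℕ) : Submodule K (TwistedField K V g) :=
  ⨆ (a : ℕ) (_ : a + codim K V g = k), LinearMap.range
    (LinearMap.lTensor (Poly K (fixedSpace K V g))
      (TensorProduct.map (⋀[K]^a (fixedSpace K V g)).subtype
        (⋀[K]^(codim K V g) (normalSpace K V g)).subtype))

variable {K V}
variable [CharZero K] [Finite G] [FiniteDimensional K V]

/-- A twisted multivector field `f ⊗ (u ⊗ w)` on `V^g` as a multivector field `f ⊗ (u ∧ w)` on `V`,
extended from `V^g` to `V = V^g ⊕ N^g` so as to be constant along `N^g`. -/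
def extend (g : G) : TwistedField K V g →ₗ[K] MVField K V :=
  TensorProduct.map (pullback (projFixed K V g)).toLinearMap
    (LinearMap.mul' K _ ∘ₗ TensorProduct.map
      (ExteriorAlgebra.map (fixedSpace K V g).subtype).toLinearMap
      (ExteriorAlgebra.map (normalSpace K V g).subtype).toLinearMap)

/-- `ξ = ∑_g ξ_g` is a `G`-invariant section of `⊕_g ∧^{k - l(g)} TV^g ⊗ ∧^{l(g)} N^g`. The group
acts by pushforward: `h` maps the fibre over `x ∈ V^g` to the fibre over `h x ∈ V^{h g h⁻¹}`. -/
structure IsInvariantField (k : ℕ) (ξ : ∀ g : G, TwistedField K V g) : Prop where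
  mem : ∀ g, ξ g ∈ twistedFields K V g k
  invariant : ∀ h g : G, ∀ x ∈ fixedSpace K V g,
    mvEval (h • x) (extend (h * g * h⁻¹) (ξ (h * g * h⁻¹))) =
      ExteriorAlgebra.map (actV K V h) (mvEval x (extend g (ξ g)))

section

variable {g : G} (e : Basis (Fin (codim K V g)) K (normalSpace K V g))

/-- The field `X` in `ξ = X ⊗ Λ_g`, where `Λ_g = ∂/∂y¹ ∧ ⋯ ∧ ∂/∂y^{l(g)}`, as a multivector field
on `V` that is constant along `N^g`; the factor `∧^{l(g)} N^g` is identified with the scalars by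
`Λ_g ↦ 1`. -/
def fixedPart : TwistedField K V g →ₗ[K] MVField K V :=
  TensorProduct.map (pullback (projFixed K V g)).toLinearMap
    ((ExteriorAlgebra.map (fixedSpace K V g).subtype).toLinearMap ∘ₗ
      (TensorProduct.rid K _).toLinearMap ∘ₗ
        LinearMap.lTensor _ (ExteriorAlgebra.liftAlternating (Pi.single (codim K V g) e.det)))

/-- `(X ♯ Ω)(f₁, …, f_{a+l}) = X(f₁, …, f_a) Ω(f_{a+1}, …, f_{a+l})`. -/
def sharp {a l : ℕ} (X : Cochain K (Poly K V) (Poly K V) a)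
    (Ω : Cochain K (Poly K V) (Poly K V) l) :
    Cochain K (Poly K V) (Poly K V) (a + l) :=
  ((LinearMap.mul' K (Poly K V)).compMultilinearMap (X.domCoprod Ω)).domDomCongr finSumFinEquiv

/-- `T₁^g(ξ) = X ♯ Ω_g` for `ξ = X ⊗ Λ_g` of degree `k`. -/
def T1Component (k : ℕ) (ξ : TwistedField K V g) : Cochain K (Poly K V) (Poly K V) k :=
  if h : codim K V g ≤ k then
    (sharp (mvOp (k - codim K V g) (fixedPart e ξ)) (twistedCocycle e)).domDomCongr
      (finCongr (Nat.sub_add_cancel h))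
  else 0

end

end TwistedFields

section Maps

variable {K : Type*} [Field K] [CharZero K] {G : Type*} [Group G] [Fintype G]
  {V : Type*} [AddCommGroup V] [Module K V] [FiniteDimensional K V]
  [DistribMulAction G V] [SMulCommClass G K V]
variable (e : ∀ g : G, Basis (Fin (codim K V g)) K (normalSpace K V g))

/-- `T₁(ξ)`, the average over `G` of `∑_g T₁^g(ξ_g) U_g`. -/
def T1 (k : ℕ) (ξ : ∀ g : G, TwistedField K V g) : Cochain K (Poly K V) (Crossed K G V) k :=
  average K (∑ g : G, ofComponent K g (T1Component (e g) k (ξ g)))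

/-- The map `T = T₂ ∘ T₁`. -/
def T (k : ℕ) (ξ : ∀ g : G, TwistedField K V g) : Cochain K (Crossed K G V) (Crossed K G V) k :=
  T2 K (T1 e k ξ)

variable {n : ℕ} (b : Basis (Fin n) K V)

/-- `L₃^g ∘ L₂^g`: the section `x ↦ pr^g(L₂^g(Ψ)(x))` over `V^g`. -/
def L32 (g : G) {m : ℕ} (Ψ : Cochain K (Poly K V) (Poly K V) m) (x : fixedSpace K V g) :
    ExteriorAlgebra K V :=
  pr K V g (L2 b Ψ x)

/-- The `g`-component of `L = L₃ ∘ L₂ ∘ L₁`, as a section over `V^g`. -/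
def L (g : G) {m : ℕ} (Ψ : Cochain K (Crossed K G V) (Crossed K G V) m) (x : fixedSpace K V g) :
    ExteriorAlgebra K V :=
  L32 b g (component K g (L1 K Ψ)) x

/-- The part `T(ξ)_α` of `T(ξ)` coming from the component `α` of `T₁(ξ)`; `T(ξ)` is the sum of
these. -/
def TPart (k : ℕ) (ξ : ∀ g : G, TwistedField K V g) (α : G) :
    Cochain K (Crossed K G V) (Crossed K G V) k :=
  T2 K (ofComponent K α (component K α (T1 e k ξ)))

/-- The contribution of `ξ_α` and `η_β` to the `αβ`-component of `L(T(ξ) ∘ T(η))`: the section over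
`V^{αβ}` that `L₃ ∘ L₂` assigns to the `αβ`-component of the restriction of `T(ξ)_α ∘ T(η)_β` to
`Poly(V)`. -/
def contribution (k l : ℕ) (ξ η : ∀ g : G, TwistedField K V g) (α β : G)
    (x : fixedSpace K V (α * β)) : ExteriorAlgebra K V :=
  L32 b (α * β) (component K (α * β)
    (restrictPoly K (gerst (TPart e k ξ α) (TPart e l η β)))) x

end Maps

end OrbifoldHochschild

/-!
For the first part, `T₁(ξ)` is an average, hence `G`-invariant, so `T(ξ)` commutes with the inner
automorphisms by the `U_h`, and so does `T(ξ) ∘ T(η)`; the average in `L₁` therefore does nothing to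
its restriction to `Poly(V)`. The pre-Lie product is bilinear, and `(T(ξ)_α ∘ T(η)_β)|_{Poly(V)}`
has values in `Poly(V) U_{αβ}` (`restrictPoly_gerst_apply`).

For the second part let `p` be a point of `V^α ∩ V^β = V^{αβ}`. The equation holds at `p` before the
projection `pr^{αβ}` is applied. It is obtained by encoding a `k`-cochain `Φ` in its symbol
`∑_J Φ(x^{j₁}, …, x^{j_k}) ∂/∂x^{j₁} ∧ ⋯ ∧ ∂/∂x^{j_k}` and rests on three facts.

* At a fixed point of `g` the difference quotients in `Ω_g` are derivatives in the directions of the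
  basis of `N^g` (`evalAt_diffQuot`), and on affine functions they are these derivatives everywhere
  (`diffQuot_affine`). So at `p` the outer cochain sees only the differentials of its arguments,
  and the inner cochain, which is applied to affine functions, agrees with the multidifferential
  operator with the factor `Λ_β` in place of `Ω_β`.
* The symbol of `T₁(ξ)_α` is `ξ_α`, extended to `V` (`symbol_component_T1`). The average over `G`
  has one term for each `h`, the translate by `h` of a cochain whose symbol is `ξ_{hαh⁻¹}` for every
  choice of basis of the normal space (`symbol_T1Component`); as `ξ` is invariant, each term has
  the symbol `ξ_α`. The operator of a homogeneous multivector field has this field as its symbol as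
  well (`symbol_mvOp`).
* Let `∑ c ⊗ w` be the symbol of `Ψ`, and `u` the value at `p` of the symbol of `Φ`. The multivector
  at `p` of the signed sum of insertions of `Ψ` into `Φ` is `∑ w ∧ (d_p c ⌋ u)`
  (`sum_slots_smul_coordVector`), so it depends on the two symbols only. In `T(ξ)_α ∘ T(η)_β` the
  arguments to the right of the inserted cochain are moved by `β`. This changes the vectors wedged
  to `w` from the right by elements of `N^β`, and `w` contains the top exterior power of `N^β`, so
  that the change is not seen (`mvDeriv_extend_mul_ι`).
-/

set_option linter.unusedSectionVars false

namespace OrbifoldHochschild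

/-! ### Bilinearity of the pre-Lie product -/

section Gerst

variable {K : Type*} [Field K] {B : Type*} [AddCommGroup B] [Module K B]

lemma insertArgs_eq_update {k l : ℕ} (ψ : Cochain K B B l) (s : Fin k)
    (a : Fin (k + l - 1) → B) :
    insertArgs ψ s a = Function.update (insertArgs (0 : Cochain K B B l) s a) s
      (ψ fun i => a ⟨s.1 + i.1, by omega⟩) := by
  funext j
  by_cases hj : j = s
  · subst hj; simp [insertArgs]
  · have : j.1 ≠ s.1 := fun h => hj (Fin.ext h)
    rw [Function.update_of_ne hj]
    simp [insertArgs, this]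

lemma gerst_apply {k l : ℕ} (φ : Cochain K B B k) (ψ : Cochain K B B l)
    (a : Fin (k + l - 1) → B) :
    gerst φ ψ a = ∑ s : Fin k, (-1 : K) ^ (s.1 * (l + 1)) • φ (insertArgs ψ s a) := by
  simp [gerst, insertion]

lemma gerst_sum_sum {ι κ : Type*} (t : Finset ι) (u : Finset κ) {k l : ℕ}
    (φ : ι → Cochain K B B k) (ψ : κ → Cochain K B B l) :
    gerst (∑ i ∈ t, φ i) (∑ j ∈ u, ψ j) = ∑ i ∈ t, ∑ j ∈ u, gerst (φ i) (ψ j) := by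
  ext a
  simp only [gerst_apply, sum_apply]
  have h : ∀ s : Fin k, ∀ i, (φ i) (insertArgs (∑ j ∈ u, ψ j) s a) =
      ∑ j ∈ u, φ i (insertArgs (ψ j) s a) := by
    intro s i
    rw [insertArgs_eq_update, sum_apply, MultilinearMap.map_update_sum]
    refine Finset.sum_congr rfl fun j _ => ?_
    rw [insertArgs_eq_update (ψ j)]
  simp only [h, Finset.smul_sum]
  rw [Finset.sum_comm]
  refine Finset.sum_congr rfl fun i _ => ?_
  rw [Finset.sum_comm]

/-- A linear map that intertwines `φ` and `ψ` intertwines their pre-Lie product. -/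
lemma gerst_map {k l : ℕ} (φ : Cochain K B B k) (ψ : Cochain K B B l) (F : B →ₗ[K] B)
    (hφ : ∀ a, φ (fun i => F (a i)) = F (φ a)) (hψ : ∀ a, ψ (fun i => F (a i)) = F (ψ a))
    (a : Fin (k + l - 1) → B) :
    gerst φ ψ (fun i => F (a i)) = F (gerst φ ψ a) := by
  simp only [gerst_apply, map_sum, map_smul]
  refine Finset.sum_congr rfl fun s _ => ?_
  rw [← hφ]
  congr 2
  funext j
  simp only [insertArgs]
  split_ifs
  · rfl
  · rw [hψ]
  · rfl

end Gerst

/-! ### Conjugation by the elements `U_h` -/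

section Conjugation

variable {K : Type*} [Field K] {G : Type*} [Group G]
  {V : Type*} [AddCommGroup V] [Module K V] [DistribMulAction G V] [SMulCommClass G K V]

lemma unitary_mul (g h : G) : unitary K V g * unitary K V h = unitary K V (g * h) := by
  simp [unitary, SkewMonoidAlgebra.single_mul_single]

lemma unitary_one : unitary K V (1 : G) = 1 := rfl

variable (K V) in
/-- The inner automorphism `c ↦ U_h c U_{h⁻¹}` of the crossed product. -/
def innerConj (h : G) : Crossed K G V →ₗ[K] Crossed K G V :=
  leftMul K V (unitary K V h) ∘ₗ rightMul K V (unitary K V h⁻¹)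

lemma innerConj_apply (h : G) (c : Crossed K G V) :
    innerConj K V h c = unitary K V h * c * unitary K V h⁻¹ := by
  simp [innerConj, leftMul, rightMul, mul_assoc]

lemma innerConj_mul (h : G) (c d : Crossed K G V) :
    innerConj K V h (c * d) = innerConj K V h c * innerConj K V h d := by
  simp only [innerConj_apply]
  have : unitary K V h⁻¹ * unitary K V h = 1 := by rw [unitary_mul, inv_mul_cancel, unitary_one]
  calc _ = unitary K V h * c * 1 * d * unitary K V h⁻¹ := by simp [mul_assoc]
    _ = _ := by rw [← this]; simp only [mul_assoc]

lemma innerConj_single (h g : G) (f : Poly K V) :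
    innerConj K V h (SkewMonoidAlgebra.single g f) =
      SkewMonoidAlgebra.single (h * g * h⁻¹) (h • f) := by
  simp [innerConj_apply, unitary, SkewMonoidAlgebra.single_mul_single]

lemma innerConj_unitary (h g : G) :
    innerConj K V h (unitary K V g) = unitary K V (h * g * h⁻¹) := by
  simp [unitary, innerConj_single]

lemma innerConj_innerConj (g h : G) (c : Crossed K G V) :
    innerConj K V g (innerConj K V h c) = innerConj K V (g * h) c := by
  simp only [innerConj_apply, mul_inv_rev, ← unitary_mul, mul_assoc]

lemma inclAt_apply (g : G) (f : Poly K V) :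
    inclAt K V g f = SkewMonoidAlgebra.single g f := rfl

lemma innerConj_inclAt (h g : G) (f : Poly K V) :
    innerConj K V h (inclAt K V g f) = inclAt K V (h * g * h⁻¹) (h • f) := by
  rw [inclAt_apply, innerConj_single, inclAt_apply]

lemma coeffAt_inclAt [DecidableEq G] (g h : G) (f : Poly K V) :
    coeffAt K V g (inclAt K V h f) = if h = g then f else 0 := by
  simp [coeffAt, inclAt_apply, SkewMonoidAlgebra.coeffLinearEquiv, Finsupp.single_apply]

lemma crossed_induction {p : Crossed K G V → Prop} (c : Crossed K G V)
    (single : ∀ g f, p (inclAt K V g f)) (add : ∀ c d, p c → p d → p (c + d)) : p c := by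
  refine SkewMonoidAlgebra.induction_on c ?_ single add
  simpa using single 1 0

lemma sum_inclAt_coeffAt [Fintype G] (c : Crossed K G V) :
    ∑ g, inclAt K V g (coeffAt K V g c) = c := by
  classical
  induction c using crossed_induction with
  | single g f =>
    rw [Finset.sum_eq_single g]
    · simp [coeffAt_inclAt]
    · intro h _ hh; simp [coeffAt_inclAt, hh.symm]
    · simp
  | add c d hc hd => simp only [map_add, Finset.sum_add_distrib, hc, hd]

lemma coeffAt_innerConj (h g : G) (c : Crossed K G V) :
    coeffAt K V (h * g * h⁻¹) (innerConj K V h c) = h • coeffAt K V g c := by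
  classical
  induction c using crossed_induction with
  | single g' f => simp [innerConj_inclAt, coeffAt_inclAt]
  | add c d hc hd => simp only [map_add, hc, hd, smul_add]

lemma conjCochain_apply (h : G) {k : ℕ} (Ψ : Cochain K (Poly K V) (Crossed K G V) k)
    (f : Fin k → Poly K V) :
    conjCochain K h Ψ f = innerConj K V h⁻¹ (Ψ fun i => h • f i) := by
  simp [conjCochain, innerConj]

lemma conjCochain_conjCochain (g h : G) {k : ℕ} (Ψ : Cochain K (Poly K V) (Crossed K G V) k) :
    conjCochain K h (conjCochain K g Ψ) = conjCochain K (g * h) Ψ := by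
  ext1 f
  simp only [conjCochain_apply, innerConj_innerConj, mul_inv_rev, mul_smul]

lemma conjCochain_average [Fintype G] (h : G) {k : ℕ}
    (Ψ : Cochain K (Poly K V) (Crossed K G V) k) :
    conjCochain K h (average K Ψ) = average K Ψ := by
  have hlin : conjCochain K h (average K Ψ) =
      (Fintype.card G : K)⁻¹ • ∑ g : G, conjCochain K h (conjCochain K g Ψ) := by
    ext1 f
    simp only [average, conjCochain_apply, smul_apply, sum_apply,
      map_smul, map_sum]
  rw [hlin]
  simp only [conjCochain_conjCochain]
  rw [average, ← Equiv.sum_comp (Equiv.mulRight h) (fun g => conjCochain K g Ψ)]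
  rfl

/-- An invariant cochain intertwines the actions of `G` on `Poly(V)` and on the crossed product. -/
lemma map_smul_of_invariant {k : ℕ} {Ψ : Cochain K (Poly K V) (Crossed K G V) k} (h : G)
    (hΨ : conjCochain K h Ψ = Ψ) (f : Fin k → Poly K V) :
    Ψ (fun i => h • f i) = innerConj K V h (Ψ f) := by
  conv_rhs => rw [← hΨ, conjCochain_apply, innerConj_innerConj, mul_inv_cancel]
  simp [innerConj_apply, unitary_one]

lemma average_of_invariant [CharZero K] [Fintype G] {k : ℕ}
    {Ψ : Cochain K (Poly K V) (Crossed K G V) k} (hΨ : ∀ h, conjCochain K h Ψ = Ψ) :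
    average K Ψ = Ψ := by
  simp only [average, hΨ, Finset.sum_const, Finset.card_univ]
  rw [← Nat.cast_smul_eq_nsmul K, smul_smul, inv_mul_cancel₀, one_smul]
  exact_mod_cast Fintype.card_ne_zero

lemma partialProd_conj (h : G) {k : ℕ} (γ : Fin k → G) (i : Fin (k + 1)) :
    Fin.partialProd (fun j => h * γ j * h⁻¹) i = h * Fin.partialProd γ i * h⁻¹ := by
  induction i using Fin.induction with
  | zero => simp
  | succ i ih => rw [Fin.partialProd_succ, Fin.partialProd_succ, ih]; group

lemma T2_apply [Fintype G] {k : ℕ} (Φ : Cochain K (Poly K V) (Crossed K G V) k)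
    (c : Fin k → Crossed K G V) :
    T2 K Φ c = ∑ γ : Fin k → G,
      Φ (fun i => Fin.partialProd γ i.castSucc • coeffAt K V (γ i) (c i)) *
        unitary K V (Fin.partialProd γ (Fin.last k)) := by
  simp [T2, rightMul]

/-- `T₂(Φ)` commutes with the inner automorphisms by the `U_h` if `Φ` is `G`-invariant. -/
lemma T2_innerConj [Fintype G] {k : ℕ} {Φ : Cochain K (Poly K V) (Crossed K G V) k} (h : G)
    (hΦ : conjCochain K h Φ = Φ) (c : Fin k → Crossed K G V) :
    T2 K Φ (fun i => innerConj K V h (c i)) = innerConj K V h (T2 K Φ c) := by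
  let E : (Fin k → G) ≃ (Fin k → G) := Equiv.piCongrRight fun _ => (MulAut.conj h).toEquiv
  rw [T2_apply, T2_apply, map_sum, ← Equiv.sum_comp E]
  refine Finset.sum_congr rfl fun γ _ => ?_
  have hE : E γ = fun j => h * γ j * h⁻¹ := rfl
  rw [hE, innerConj_mul, ← map_smul_of_invariant h hΦ, innerConj_unitary]
  simp only [partialProd_conj, coeffAt_innerConj, mul_smul, inv_smul_smul]

lemma T2_sum [Fintype G] {ι : Type*} (t : Finset ι) {k : ℕ}
    (Φ : ι → Cochain K (Poly K V) (Crossed K G V) k) :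
    T2 K (∑ i ∈ t, Φ i) = ∑ i ∈ t, T2 K (Φ i) := by
  ext1 c
  simp only [T2_apply, sum_apply, Finset.sum_mul]
  rw [Finset.sum_comm]

lemma restrictPoly_apply {k : ℕ} (Ψ : Cochain K (Crossed K G V) (Crossed K G V) k)
    (f : Fin k → Poly K V) : restrictPoly K Ψ f = Ψ fun i => inclAt K V 1 (f i) := by
  simp [restrictPoly]

lemma component_apply (g : G) {k : ℕ} (Ψ : Cochain K (Poly K V) (Crossed K G V) k)
    (f : Fin k → Poly K V) : component K g Ψ f = coeffAt K V g (Ψ f) := by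
  simp [component]

lemma ofComponent_apply (g : G) {k : ℕ} (Ψ : Cochain K (Poly K V) (Poly K V) k)
    (f : Fin k → Poly K V) : ofComponent K g Ψ f = inclAt K V g (Ψ f) := by
  simp [ofComponent]

lemma sum_ofComponent_component [Fintype G] {k : ℕ}
    (Φ : Cochain K (Poly K V) (Crossed K G V) k) :
    ∑ g, ofComponent K g (component K g Φ) = Φ := by
  ext1 f
  simp only [sum_apply, ofComponent_apply, component_apply, sum_inclAt_coeffAt]

lemma restrictPoly_gerst_invariant [Fintype G] {k l : ℕ}
    {Φ : Cochain K (Poly K V) (Crossed K G V) k} {Ψ : Cochain K (Poly K V) (Crossed K G V) l}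
    (h : G) (hΦ : conjCochain K h Φ = Φ) (hΨ : conjCochain K h Ψ = Ψ) :
    conjCochain K h (restrictPoly K (gerst (T2 K Φ) (T2 K Ψ))) =
      restrictPoly K (gerst (T2 K Φ) (T2 K Ψ)) := by
  ext1 f
  have h1 : ∀ i, inclAt K V 1 (h • f i) = innerConj K V h (inclAt K V (1 : G) (f i)) := by
    intro i; rw [innerConj_inclAt]; simp
  rw [conjCochain_apply, restrictPoly_apply, restrictPoly_apply]
  simp only [h1]
  rw [gerst_map _ _ (innerConj K V h) (T2_innerConj h hΦ) (T2_innerConj h hΨ),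
    innerConj_innerConj, inv_mul_cancel]
  simp [innerConj_apply, unitary_one]

/-- The arguments of the outer cochain in `(T₂(Φ U_α) ∘ T₂(Ψ U_β))|_{Poly(V)}`: the inner cochain
`Ψ` is inserted in the slot `s`, and the arguments to its right are moved by `β`, since they are
commuted past the factor `U_β` of the inserted value. -/
def twistedArgs (β : G) {k l : ℕ} (Ψ : Cochain K (Poly K V) (Poly K V) l) (s : Fin k)
    (f : Fin (k + l - 1) → Poly K V) (j : Fin k) : Poly K V :=
  if s < j then β • insertArgs Ψ s f j else insertArgs Ψ s f j

lemma partialProd_ite (β : G) {k : ℕ} (s : Fin k) (i : Fin (k + 1)) :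
    Fin.partialProd (fun j => if j = s then β else 1) i = if s.1 < i.1 then β else 1 := by
  induction i using Fin.induction with
  | zero => simp
  | succ i ih =>
    rw [Fin.partialProd_succ, ih]
    rcases lt_trichotomy i.1 s.1 with h | h | h
    · have h1 : i ≠ s := fun h' => by omega
      have h2 : ¬ s.1 < i.1 + 1 := by omega
      simp [h1, h2, not_lt.2 (Fin.le_def.2 h.le)]
    · have h1 : i = s := Fin.ext h
      simp [h1]
    · have h1 : i ≠ s := fun h' => by omega
      have h2 : s.1 < i.1 + 1 := by omega
      simp [h1, h2, h]

lemma T2_ofComponent_inclAt_one [Fintype G] (β : G) {l : ℕ}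
    (Ψ : Cochain K (Poly K V) (Poly K V) l) (f : Fin l → Poly K V) :
    T2 K (ofComponent K β Ψ) (fun i => inclAt K V 1 (f i)) = inclAt K V β (Ψ f) := by
  have h : ∀ i : Fin (l + 1), Fin.partialProd (fun _ : Fin l => (1 : G)) i = 1 := by
    intro i
    induction i using Fin.induction with
    | zero => simp
    | succ i ih => rw [Fin.partialProd_succ, ih, mul_one]
  have := T2_single K (ofComponent K β Ψ) f (fun _ => (1 : G))
  simp only [h, one_smul, unitary_one, mul_one, ofComponent_apply] at this
  exact this

/-- The restriction of `T₂(Φ U_α) ∘ T₂(Ψ U_β)` to `Poly(V)` has values in `Poly(V) U_{αβ}`; it is the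
pre-Lie product of `Φ` and `Ψ` with the arguments right of the insertion moved by `β`. -/
lemma restrictPoly_gerst_apply [Fintype G] (α β : G) {k l : ℕ}
    (Φ : Cochain K (Poly K V) (Poly K V) k) (Ψ : Cochain K (Poly K V) (Poly K V) l)
    (f : Fin (k + l - 1) → Poly K V) :
    restrictPoly K (gerst (T2 K (ofComponent K α Φ)) (T2 K (ofComponent K β Ψ))) f =
      inclAt K V (α * β)
        (∑ s : Fin k, (-1 : K) ^ (s.1 * (l + 1)) • Φ (twistedArgs β Ψ s f)) := by
  rw [restrictPoly_apply, gerst_apply, map_sum]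
  refine Finset.sum_congr rfl fun s _ => ?_
  rw [map_smul]
  congr 1
  have h1 : insertArgs (T2 K (ofComponent K β Ψ)) s (fun i => inclAt K V 1 (f i)) =
      fun j => SkewMonoidAlgebra.single (if j = s then β else 1) (insertArgs Ψ s f j) := by
    funext j
    simp only [insertArgs, Fin.ext_iff]
    split_ifs with h1 h2 h2
    · omega
    · rfl
    · exact T2_ofComponent_inclAt_one _ _ _
    · rfl
  rw [h1, T2_single]
  simp only [partialProd_ite, ofComponent_apply]
  have h2 : (if s.1 < (Fin.last k).1 then β else 1) = β := if_pos s.2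
  rw [h2]
  simp only [inclAt_apply, unitary, SkewMonoidAlgebra.single_mul_single, smul_one, mul_one]
  congr 2
  funext j
  simp only [twistedArgs, Fin.val_castSucc, Fin.lt_def]
  split_ifs <;> simp

lemma component_restrictPoly_gerst [Fintype G] [DecidableEq G] (g α β : G) {k l : ℕ}
    (Φ : Cochain K (Poly K V) (Poly K V) k) (Ψ : Cochain K (Poly K V) (Poly K V) l)
    (f : Fin (k + l - 1) → Poly K V) :
    component K g (restrictPoly K (gerst (T2 K (ofComponent K α Φ)) (T2 K (ofComponent K β Ψ)))) f =
      if α * β = g then ∑ s : Fin k, (-1 : K) ^ (s.1 * (l + 1)) • Φ (twistedArgs β Ψ s f)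
      else 0 := by
  rw [component_apply, restrictPoly_gerst_apply, coeffAt_inclAt]

end Conjugation

/-! ### The components of `L(T(ξ) ∘ T(η))` -/

section ComponentFormula

variable {K : Type*} [Field K] [CharZero K] {G : Type*} [Group G] [Fintype G]
  {V : Type*} [AddCommGroup V] [Module K V] [FiniteDimensional K V]
  [DistribMulAction G V] [SMulCommClass G K V]
variable (e : ∀ g : G, Basis (Fin (codim K V g)) K (normalSpace K V g))
variable {n : ℕ} (b : Basis (Fin n) K V)

lemma L2_sum {ι : Type*} (t : Finset ι) {m : ℕ} (Ψ : ι → Cochain K (Poly K V) (Poly K V) m)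
    (p : V) : L2 b (∑ i ∈ t, Ψ i) p = ∑ i ∈ t, L2 b (Ψ i) p := by
  simp only [L2, sum_apply, map_sum, Finset.smul_sum, Finset.mul_sum]
  rw [Finset.sum_comm]
  refine Finset.sum_congr rfl fun I _ => ?_
  rw [← Finset.sum_smul, Finset.sum_comm]

lemma sum_TPart (k : ℕ) (ξ : ∀ g : G, TwistedField K V g) :
    ∑ α, TPart e k ξ α = T e k ξ := by
  simp only [TPart, T]
  rw [← T2_sum, sum_ofComponent_component]

/-- The `g`-component of `L(T(ξ) ∘ T(η))` is the sum of the contributions of the pairs `α`, `β` with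
`αβ = g`. -/
theorem L_gerst_eq_sum_contribution (k l : ℕ) (ξ η : ∀ g : G, TwistedField K V g) (g : G)
    (x : fixedSpace K V g) :
    L b g (gerst (T e k ξ) (T e l η)) x =
      ∑ α : G, contribution e b k l ξ η α (α⁻¹ * g)
        ⟨x, by rw [mul_inv_cancel_left]; exact x.2⟩ := by
  classical
  have h1 : L1 K (gerst (T e k ξ) (T e l η)) = restrictPoly K (gerst (T e k ξ) (T e l η)) :=
    average_of_invariant fun h =>
      restrictPoly_gerst_invariant h (conjCochain_average h _) (conjCochain_average h _)
  have h2 : component K g (restrictPoly K (gerst (T e k ξ) (T e l η))) =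
      ∑ α : G, component K g (restrictPoly K (gerst (TPart e k ξ α) (TPart e l η (α⁻¹ * g)))) := by
    rw [← sum_TPart, ← sum_TPart, gerst_sum_sum]
    ext1 f
    have h3 : ∀ α β, component K g
        (restrictPoly K (gerst (TPart e k ξ α) (TPart e l η β))) f =
        if β = α⁻¹ * g then component K g
          (restrictPoly K (gerst (TPart e k ξ α) (TPart e l η (α⁻¹ * g)))) f else 0 := by
      intro α β
      split_ifs with h
      · rw [h]
      · rw [TPart, TPart, component_restrictPoly_gerst, if_neg]
        rintro rfl
        exact h (by group)
    simp only [component_apply, restrictPoly_apply, sum_apply, map_sum] at h3 ⊢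
    refine Finset.sum_congr rfl fun α _ => ?_
    rw [Finset.sum_congr rfl fun β _ => h3 α β]
    simp
  have h4 : ∀ (Ξ : Cochain K (Poly K V) (Crossed K G V) (k + l - 1)) (g' : G) (_ : g' = g)
      (hx : (x : V) ∈ fixedSpace K V g'),
      L32 b g' (component K g' Ξ) ⟨x, hx⟩ = L32 b g (component K g Ξ) x := by
    rintro Ξ _ rfl hx; rfl
  rw [L, h1, h2, L32, L2_sum, map_sum]
  refine Finset.sum_congr rfl fun α _ => ?_
  exact (h4 _ _ (mul_inv_cancel_left α g) _).symm

end ComponentFormula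

/-! ### Inserting a vector-valued form into a multilinear form -/

section Insertion

variable {K : Type*} [Field K] {V : Type*} [AddCommGroup V] [Module K V]
variable {n : ℕ} (b : Basis (Fin n) K V)

/-- The expansion of a multilinear form on `V*` in the coordinates of `b`. -/
lemma multilinear_form_eq_sum {k : ℕ} (φ : MultilinearMap K (fun _ : Fin k => Dual K V) K)
    (θ : Fin k → Dual K V) :
    φ θ = ∑ L : Fin k → Fin n, (∏ j, θ j (b (L j))) * φ (fun j => b.coord (L j)) := by
  have h : θ = fun j => ∑ i, θ j (b i) • b.coord i := by
    funext j; exact (b.sum_dual_apply_smul_coord (θ j)).symm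
  conv_lhs => rw [h, MultilinearMap.map_sum]
  refine Finset.sum_congr rfl fun L _ => ?_
  rw [MultilinearMap.map_smul_univ, smul_eq_mul]

lemma sum_prod_coord_smul_coordVector {k : ℕ} (v : Fin k → V) :
    ∑ I : Fin k → Fin n, (∏ j, b.coord (I j) (v j)) • coordVector b I =
      ExteriorAlgebra.ιMulti K k v := by
  have h : v = fun j => ∑ i, b.coord i (v j) • b i := by
    funext j; exact (b.sum_repr (v j)).symm
  conv_rhs => rw [h, ← AlternatingMap.coe_multilinearMap, MultilinearMap.map_sum]
  refine Finset.sum_congr rfl fun I _ => ?_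
  rw [MultilinearMap.map_smul_univ]
  rfl

lemma coordVector_append {k l : ℕ} (I : Fin k → Fin n) (J : Fin l → Fin n) :
    coordVector b (Fin.append I J) = coordVector b I * coordVector b J := by
  rw [coordVector, coordVector, coordVector, ExteriorAlgebra.ιMulti_mul_ιMulti]
  congr 1
  funext i
  refine Fin.addCases (fun i => ?_) (fun i => ?_) i <;> simp

lemma coordVector_comp_cast {k l : ℕ} (h : k = l) (I : Fin l → Fin n) :
    coordVector b (fun i => I (Fin.cast h i)) = coordVector b I := by
  subst h; rfl

/-- The covectors paired with the slots of a `k`-vector when a covector-valued function `D` of `l`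
indices is inserted in the slot `s`; the coordinates to its right are precomposed with `A`. -/
def slotCovector {k l : ℕ} (D : (Fin l → Fin n) → Dual K V) (A : V →ₗ[K] V) (s : Fin k)
    (I : Fin (k + l - 1) → Fin n) (j : Fin k) : Dual K V :=
  if h : j.1 < s.1 then b.coord (I ⟨j.1, by omega⟩)
  else if h' : j.1 = s.1 then D (fun i => I ⟨s.1 + i.1, by omega⟩)
  else b.coord (I ⟨j.1 + l - 1, by omega⟩) ∘ₗ A

/-- The sum over all multi-indices factors into the vectors left of the slot, the inserted
multivector, and the vectors right of the slot. -/
lemma sum_slotCovector {k l : ℕ} (D : (Fin l → Fin n) → Dual K V) (A : V →ₗ[K] V) (s : Fin k)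
    (v : Fin k → V) :
    ∑ I : Fin (k + l - 1) → Fin n, (∏ j, slotCovector b D A s I j (v j)) • coordVector b I =
      ((List.ofFn fun j => ExteriorAlgebra.ι K (v j)).take s).prod *
        (∑ J : Fin l → Fin n, D J (v s) • coordVector b J) *
          ((List.ofFn fun j => ExteriorAlgebra.ι K (A (v j))).drop (s + 1)).prod := by
  obtain ⟨s, hs⟩ := s
  obtain ⟨t, rfl⟩ : ∃ t, k = s + 1 + t := ⟨k - (s + 1), by omega⟩
  have hm : s + 1 + t + l - 1 = s + l + t := by omega
  have h1 : (List.ofFn fun j => ExteriorAlgebra.ι K (v j)).take s =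
      List.ofFn fun j : Fin s => ExteriorAlgebra.ι K (v (Fin.castAdd t (Fin.castAdd 1 j))) := by
    rw [List.ofFn_add, List.ofFn_add, List.append_assoc, List.take_append_of_le_length (by simp),
      List.take_of_length_le (by simp)]
    rfl
  have h2 : (List.ofFn fun j => ExteriorAlgebra.ι K (A (v j))).drop (s + 1) =
      List.ofFn fun j : Fin t => ExteriorAlgebra.ι K (A (v (Fin.natAdd (s + 1) j))) := by
    rw [List.ofFn_add, List.drop_left' (by simp)]
  simp only [h1, h2]
  let E : ((Fin s → Fin n) × (Fin l → Fin n)) × (Fin t → Fin n) ≃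
      (Fin (s + 1 + t + l - 1) → Fin n) :=
    ((Fin.appendEquiv s l).prodCongr (Equiv.refl _)).trans
      ((Fin.appendEquiv (s + l) t).trans ((finCongr hm.symm).arrowCongr (Equiv.refl _)))
  have hE : ∀ P J Q, E ((P, J), Q) =
      fun i => Fin.append (Fin.append P J) Q (Fin.cast hm i) := fun _ _ _ => rfl
  rw [← Equiv.sum_comp E, Fintype.sum_prod_type, Fintype.sum_prod_type]
  have h3 : ∀ P J Q, (∏ j, slotCovector b D A ⟨s, hs⟩ (E ((P, J), Q)) j (v j)) •
      coordVector b (E ((P, J), Q)) =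
      ((∏ j : Fin s, b.coord (P j) (v (Fin.castAdd t (Fin.castAdd 1 j)))) • coordVector b P) *
        (D J (v ⟨s, hs⟩) • coordVector b J) *
        ((∏ j : Fin t, b.coord (Q j) (A (v (Fin.natAdd (s + 1) j)))) • coordVector b Q) := by
    intro P J Q
    have e1 : ∀ j : Fin s, slotCovector b D A ⟨s, hs⟩ (E ((P, J), Q))
        (Fin.castAdd t (Fin.castAdd 1 j)) = b.coord (P j) := by
      intro j
      have : (Fin.cast hm ⟨j.1, by omega⟩) = Fin.castAdd t (Fin.castAdd l j) := rfl
      simp [slotCovector, hE, this]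
    have e2 : slotCovector b D A ⟨s, hs⟩ (E ((P, J), Q)) ⟨s, hs⟩ = D J := by
      have : ∀ i : Fin l, (Fin.cast hm ⟨s + i.1, by omega⟩) =
        Fin.castAdd t (Fin.natAdd s i) := fun _ => rfl
      simp [slotCovector, hE, this]
    have e3 : ∀ j : Fin t, slotCovector b D A ⟨s, hs⟩ (E ((P, J), Q))
        (Fin.natAdd (s + 1) j) = b.coord (Q j) ∘ₗ A := by
      intro j
      have h4 : (Fin.cast hm ⟨s + 1 + j.1 + l - 1, by omega⟩) = Fin.natAdd (s + l) j :=
        Fin.ext (by simp; omega)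
      have h5 : ¬ s + 1 + j.1 < s := by omega
      have h6 : ¬ s + 1 + j.1 = s := by omega
      simp [slotCovector, hE, h4, h5, h6]
    have e4 : Fin.castAdd t (Fin.natAdd s (0 : Fin 1)) = ⟨s, hs⟩ := rfl
    rw [Fin.prod_univ_add, Fin.prod_univ_add, hE, coordVector_comp_cast, coordVector_append,
      coordVector_append, ← hE]
    simp only [Fin.prod_univ_one, e4, e1, e2, e3, LinearMap.comp_apply]
    simp only [smul_mul_assoc, mul_smul_comm, smul_smul]
    congr 1
    ring
  simp only [h3]
  rw [← ExteriorAlgebra.ιMulti_apply, ← ExteriorAlgebra.ιMulti_apply,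
    ← sum_prod_coord_smul_coordVector b, ← sum_prod_coord_smul_coordVector b,
    Finset.sum_mul_sum, Finset.sum_mul]
  refine Finset.sum_congr rfl fun P _ => ?_
  rw [Finset.sum_mul]
  refine Finset.sum_congr rfl fun J _ => ?_
  rw [Finset.mul_sum]

/-- The interior product of a covector with `x₀ ∧ ⋯ ∧ x_{k-1}`. -/
lemma contractLeft_prod_map_ι (d : Dual K V) (xs : List V) :
    CliffordAlgebra.contractLeft d (xs.map (ExteriorAlgebra.ι K)).prod =
      ∑ i ∈ Finset.range xs.length, ((-1 : K) ^ i * d (xs.getD i 0)) •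
        (((xs.map (ExteriorAlgebra.ι K)).take i).prod *
          ((xs.map (ExteriorAlgebra.ι K)).drop (i + 1)).prod) := by
  induction xs with
  | nil => simp [CliffordAlgebra.contractLeft_one]
  | cons x xs ih =>
    rw [List.map_cons, List.prod_cons]
    refine (CliffordAlgebra.contractLeft_ι_mul d x _).trans ?_
    rw [ih, List.length_cons, Finset.sum_range_succ', add_comm, sub_eq_add_neg]
    congr 1
    · simp
    · rw [Finset.mul_sum, ← Finset.sum_neg_distrib]
      refine Finset.sum_congr rfl fun i _ => ?_
      simp only [List.getD_cons_succ, List.take_succ_cons, List.drop_succ_cons, List.prod_cons,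
        pow_succ, mul_neg_one, neg_mul, neg_smul, mul_smul_comm, mul_assoc]

lemma ι_mul_ι_comm (x y : V) : ExteriorAlgebra.ι K x * ExteriorAlgebra.ι K y =
    -(ExteriorAlgebra.ι K y * ExteriorAlgebra.ι K x) :=
  eq_neg_of_add_eq_zero_left (ExteriorAlgebra.ι_add_mul_swap x y)

lemma ι_mul_prod_map_ι (x : V) (ys : List V) :
    ExteriorAlgebra.ι K x * (ys.map (ExteriorAlgebra.ι K)).prod =
      (-1 : K) ^ ys.length • ((ys.map (ExteriorAlgebra.ι K)).prod * ExteriorAlgebra.ι K x) := by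
  induction ys with
  | nil => simp
  | cons y ys ih =>
    rw [List.map_cons, List.prod_cons, ← mul_assoc, ι_mul_ι_comm, neg_mul, mul_assoc, ih,
      List.length_cons, pow_succ, mul_neg_one, neg_smul, mul_smul_comm, mul_assoc]

lemma prod_map_ι_comm (xs ys : List V) :
    (xs.map (ExteriorAlgebra.ι K)).prod * (ys.map (ExteriorAlgebra.ι K)).prod =
      (-1 : K) ^ (xs.length * ys.length) •
        ((ys.map (ExteriorAlgebra.ι K)).prod * (xs.map (ExteriorAlgebra.ι K)).prod) := by
  induction xs with
  | nil => simp
  | cons x xs ih =>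
    rw [List.map_cons, List.prod_cons, mul_assoc, ih, mul_smul_comm, ← mul_assoc,
      ι_mul_prod_map_ι, smul_mul_assoc, smul_smul, List.length_cons, mul_assoc, ← pow_add]
    congr 2
    ring

/-- If `Z` is annihilated by the vectors `A y - y`, then the vectors wedged to it from the right may
be moved by `A`. -/
lemma mul_prod_map_eq_of_annihilates (A : V →ₗ[K] V) (xs : List V) (Z : ExteriorAlgebra K V)
    (hZ : ∀ y, Z * ExteriorAlgebra.ι K (A y) = Z * ExteriorAlgebra.ι K y) :
    Z * (xs.map fun x => ExteriorAlgebra.ι K (A x)).prod =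
      Z * (xs.map (ExteriorAlgebra.ι K)).prod := by
  induction xs generalizing Z with
  | nil => simp
  | cons x xs ih =>
    rw [List.map_cons, List.map_cons, List.prod_cons, List.prod_cons, ← mul_assoc, ← mul_assoc, hZ]
    refine ih _ fun y => ?_
    rw [mul_assoc, mul_assoc, ι_mul_ι_comm, ι_mul_ι_comm x y, mul_neg, mul_neg, ← mul_assoc,
      ← mul_assoc, hZ]

/-- The alternating sum over the slots of a multilinear form `φ`, expanded in coordinate
multivectors, depends only on the multivector `u` of `φ` and on the covector-valued multivector
`∑_J D_J ⊗ e_J` that is inserted: it is `∑_J e_J ∧ (D_J ⌋ u)`. The maps `A` applied to the right of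
the slot have no effect if `∑_J D_J ⊗ e_J` is annihilated by the vectors `A y - y`. -/
theorem sum_slots_smul_coordVector {k l : ℕ}
    (φ : MultilinearMap K (fun _ : Fin k => Dual K V) K)
    (D : (Fin l → Fin n) → Dual K V) (A : V →ₗ[K] V)
    (hA : ∀ x y, (∑ J, D J x • coordVector b J) * ExteriorAlgebra.ι K (A y) =
      (∑ J, D J x • coordVector b J) * ExteriorAlgebra.ι K y) :
    ∑ I : Fin (k + l - 1) → Fin n,
      (∑ s : Fin k, (-1 : K) ^ (s.1 * (l + 1)) * φ (slotCovector b D A s I)) • coordVector b I =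
    ∑ J : Fin l → Fin n, coordVector b J * CliffordAlgebra.contractLeft (D J)
      (∑ L : Fin k → Fin n, φ (fun j => b.coord (L j)) • coordVector b L) := by
  have h1 : ∀ L : Fin k → Fin n, ∑ s : Fin k, (-1 : K) ^ (s.1 * (l + 1)) •
      ∑ I : Fin (k + l - 1) → Fin n,
        (∏ j, slotCovector b D A s I j (b (L j))) • coordVector b I =
      ∑ J : Fin l → Fin n, coordVector b J *
        CliffordAlgebra.contractLeft (D J) (coordVector b L) := by
    intro L
    have hL : ∀ {m : ℕ} (L : Fin m → Fin n), coordVector b L =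
        ((List.ofFn fun j => b (L j)).map (ExteriorAlgebra.ι K)).prod := by
      intro m L
      rw [coordVector, ExteriorAlgebra.ιMulti_apply, List.map_ofFn]; rfl
    have hR := fun J => contractLeft_prod_map_ι (D J) (List.ofFn fun j => b (L j))
    simp only [← hL L, List.length_ofFn] at hR
    simp only [hR, Finset.mul_sum]
    rw [Finset.sum_comm (s := Finset.univ (α := Fin l → Fin n)),
      ← Fin.sum_univ_eq_sum_range (fun i => ∑ J : Fin l → Fin n,
      coordVector b J * ((-1 : K) ^ i * (D J) ((List.ofFn fun j => b (L j)).getD i 0)) •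
        ((((List.ofFn fun j => b (L j)).map (ExteriorAlgebra.ι K)).take i).prod *
          (((List.ofFn fun j => b (L j)).map (ExteriorAlgebra.ι K)).drop (i + 1)).prod))]
    refine Finset.sum_congr rfl fun s _ => ?_
    rw [sum_slotCovector, mul_assoc]
    have e1 : (List.ofFn fun j => ExteriorAlgebra.ι K (A (b (L j)))).drop (s.1 + 1) =
        ((List.ofFn fun j => b (L j)).drop (s.1 + 1)).map
          (fun x => ExteriorAlgebra.ι K (A x)) := by
      rw [List.map_drop, List.map_ofFn]; rfl
    have e2 : (List.ofFn fun j => ExteriorAlgebra.ι K (b (L j))).take s.1 =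
        ((List.ofFn fun j => b (L j)).take s.1).map (ExteriorAlgebra.ι K) := by
      rw [List.map_take, List.map_ofFn]; rfl
    rw [e1, e2, mul_prod_map_eq_of_annihilates _ _ _ (hA _), Finset.sum_mul, Finset.mul_sum,
      Finset.smul_sum]
    refine Finset.sum_congr rfl fun J _ => ?_
    have e3 : (List.ofFn fun j => b (L j)).getD s.1 0 = b (L s) := by
      simp [List.getD_eq_getElem?_getD]
    rw [e3, hL J, ← List.map_take, ← List.map_drop, smul_mul_assoc, mul_smul_comm, ← mul_assoc,
      prod_map_ι_comm, smul_mul_assoc, mul_smul_comm, smul_smul, smul_smul, mul_assoc]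
    congr 1
    swap
    · rw [mul_assoc]
    have e4 : ((List.ofFn fun j => b (L j)).take s.1).length = s.1 := by
      simp
    -- The sign of the slot and the sign of moving the `l`-vector past `s` vectors give the sign
    -- in the interior product.
    have e5 : (-1 : K) ^ (s.1 * (l + 1)) * (-1) ^ (s.1 * l) = (-1) ^ s.1 := by
      rw [← pow_add]
      have : s.1 * (l + 1) + s.1 * l = 2 * (s.1 * l) + s.1 := by ring
      rw [this, pow_add, pow_mul]; simp
    rw [e4, List.length_ofFn, ← e5]
    ring
  -- By multilinearity, `φ` may be taken to be the pairing with a tensor of basis vectors.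
  have h2 : ∀ I (s : Fin k), φ (slotCovector b D A s I) = _ := fun I s =>
    multilinear_form_eq_sum b φ _
  simp only [h2, map_sum, map_smul, Finset.mul_sum, mul_smul_comm]
  rw [Finset.sum_comm (s := Finset.univ (α := Fin l → Fin n))]
  simp only [← Finset.smul_sum, ← h1]
  simp only [Finset.sum_smul, Finset.smul_sum, smul_smul]
  rw [Finset.sum_comm, Finset.sum_comm (s := Finset.univ (α := Fin k → Fin n))]
  refine Finset.sum_congr rfl fun s _ => ?_
  rw [Finset.sum_comm]
  refine Finset.sum_congr rfl fun L _ => Finset.sum_congr rfl fun I _ => ?_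
  congr 1
  ring

end Insertion

/-! ### Values and differentials of polynomial functions -/

section Differential

variable {K : Type*} [Field K] {V : Type*} [AddCommGroup V] [Module K V]
  {W : Type*} [AddCommGroup W] [Module K W]

lemma poly_induction {p : Poly K V → Prop} (f : Poly K V)
    (const : ∀ r, p (algebraMap K _ r)) (lin : ∀ φ, p (linFun K φ))
    (mul : ∀ f g, p f → p g → p (f * g)) (add : ∀ f g, p f → p g → p (f + g)) : p f := by
  induction f using SymmetricAlgebra.induction with
  | algebraMap r => exact const r
  | ι φ => exact lin φ
  | mul a b ha hb => exact mul a b ha hb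
  | add a b ha hb => exact add a b ha hb

@[simp] lemma dirDeriv_algebraMap (v : V) (c : K) : dirDeriv v (algebraMap K (Poly K V) c) = 0 := by
  simp [dirDeriv, AlgHom.commutes, TrivSqZeroExt.algebraMap_eq_inl']

lemma dirDeriv_pullback (S : W →ₗ[K] V) (w : W) (f : Poly K V) :
    dirDeriv w (pullback S f) = pullback S (dirDeriv (S w) f) := by
  induction f using poly_induction with
  | const r => rw [AlgHom.commutes]; simp
  | lin φ => rw [pullback_linFun, dirDeriv_linFun, dirDeriv_linFun]; simp
  | mul a b ha hb => simp only [map_mul, map_add, dirDeriv_mul, ha, hb]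
  | add a b ha hb => simp only [map_add, ha, hb]

/-- The differential of a polynomial function at the point `p`. -/
def differential (p : V) : Poly K V →ₗ[K] Dual K V :=
  (dirDeriv.compr₂ (evalAt K p).toLinearMap).flip

lemma differential_apply (p v : V) (f : Poly K V) :
    differential p f v = evalAt K p (dirDeriv v f) := rfl

@[simp] lemma differential_linFun (p : V) (φ : Dual K V) : differential p (linFun K φ) = φ := by
  ext v; rw [differential_apply, dirDeriv_linFun]; simp

@[simp] lemma differential_algebraMap (p : V) (c : K) :
    differential p (algebraMap K (Poly K V) c) = 0 := by
  ext v; simp [differential_apply]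

lemma differential_pullback (S : W →ₗ[K] V) (p : W) (f : Poly K V) :
    differential p (pullback S f) = differential (S p) f ∘ₗ S := by
  ext v
  simp [differential_apply, dirDeriv_pullback]

/-- A polynomial function over an infinite field is determined by its values. -/
lemma poly_ext [Infinite K] {n : ℕ} (b : Basis (Fin n) K V) {f g : Poly K V}
    (h : ∀ x, evalAt K x f = evalAt K x g) : f = g := by
  let Θ := SymmetricAlgebra.equivMvPolynomial b.dualBasis
  have key : ∀ (c : Fin n → K) (f : Poly K V),
      MvPolynomial.eval c (Θ f) = evalAt K (∑ i, c i • b i) f := by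
    intro c f
    have : (MvPolynomial.aeval c).comp Θ.toAlgHom = evalAt K (∑ i, c i • b i) := by
      apply SymmetricAlgebra.algHom_ext
      refine b.dualBasis.ext fun i => ?_
      have h1 : Θ (linFun K (b.dualBasis i)) = MvPolynomial.X i :=
        SymmetricAlgebra.equivMvPolynomial_ι_apply b.dualBasis i
      have h2 := evalAt_linFun (K := K) (∑ i, c i • b i) (b.dualBasis i)
      refine Eq.trans ?_ h2.symm
      refine (congrArg (MvPolynomial.aeval c) h1).trans ?_
      simp [Finsupp.single_apply]
    exact DFunLike.congr_fun this f
  apply Θ.injective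
  apply MvPolynomial.funext
  intro c
  rw [key, key, h]

/-- A polynomial multivector field over an infinite field is determined by its values. -/
lemma mvField_ext [Infinite K] {n : ℕ} (b : Basis (Fin n) K V) {Y Z : MVField K V}
    (h : ∀ x, mvEval x Y = mvEval x Z) : Y = Z := by
  classical
  let 𝒞 := Basis.ofVectorSpace K (ExteriorAlgebra K V)
  apply (TensorProduct.equivFinsuppOfBasisRight (M := Poly K V) 𝒞).injective
  ext i
  have key : ∀ x (Y : MVField K V),
      evalAt K x (TensorProduct.equivFinsuppOfBasisRight 𝒞 Y i) = 𝒞.repr (mvEval x Y) i := by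
    intro x Y
    induction Y using TensorProduct.induction_on with
    | zero => simp
    | tmul c w => simp [mul_comm]
    | add Y Z hY hZ => simp [hY, hZ]
  exact poly_ext b fun x => by rw [key, key, h]

/-- The derivative at `p` in the direction `v` of a multivector field, an element of `∧^• V`. -/
def mvDeriv (p v : V) : MVField K V →ₗ[K] ExteriorAlgebra K V :=
  (TensorProduct.lid K _).toLinearMap ∘ₗ
    LinearMap.rTensor _ ((evalAt K p).toLinearMap ∘ₗ dirDeriv v)

@[simp] lemma mvDeriv_tmul (p v : V) (c : Poly K V) (w : ExteriorAlgebra K V) :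
    mvDeriv p v (c ⊗ₜ[K] w) = differential p c v • w := by
  simp [mvDeriv, differential_apply]

/-- The map `c ⊗ w ↦ w ∧ (d_p c ⌋ u)`. -/
def contractInsert (p : V) (u : ExteriorAlgebra K V) : MVField K V →ₗ[K] ExteriorAlgebra K V :=
  TensorProduct.lift <| LinearMap.flip <|
    (LinearMap.mul K (ExteriorAlgebra K V)).compl₂
      ((LinearMap.flip (CliffordAlgebra.contractLeft (Q := (0 : QuadraticForm K V))) u) ∘ₗ
        differential p)

@[simp] lemma contractInsert_tmul (p : V) (u : ExteriorAlgebra K V) (c : Poly K V)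
    (w : ExteriorAlgebra K V) :
    contractInsert p u (c ⊗ₜ[K] w) = w * CliffordAlgebra.contractLeft (differential p c) u := by
  simp [contractInsert]

end Differential

/-! ### Symbols of cochains -/

section Symbol

variable {K : Type*} [Field K] {V : Type*} [AddCommGroup V] [Module K V]
variable {n : ℕ} (b : Basis (Fin n) K V)

/-- The multivector field `∑_J Φ(x^{j₁}, …, x^{j_k}) ∂/∂x^{j₁} ∧ ⋯ ∧ ∂/∂x^{j_k}` of a cochain. -/
def symbol {k : ℕ} (Φ : Cochain K (Poly K V) (Poly K V) k) : MVField K V :=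
  ∑ J : Fin k → Fin n, Φ (fun j => linFun K (b.coord (J j))) ⊗ₜ[K] coordVector b J

/-- The value of `Φ` at `p` depends on the arguments only through their differentials at `p`. -/
def IsFirstOrderAt {k : ℕ} (Φ : Cochain K (Poly K V) (Poly K V) k) (p : V) : Prop :=
  ∀ f, evalAt K p (Φ f) = evalAt K p (Φ fun j => linFun K (differential p (f j)))

/-- `Φ` takes the same value on affine functions as on their linear parts. -/
def IgnoresConstants {k : ℕ} (Φ : Cochain K (Poly K V) (Poly K V) k) : Prop :=
  ∀ (θ : Fin k → Dual K V) (c : Fin k → K),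
    Φ (fun j => linFun K (θ j) - algebraMap K (Poly K V) (c j)) = Φ fun j => linFun K (θ j)

lemma mvEval_symbol {k : ℕ} (Φ : Cochain K (Poly K V) (Poly K V) k) (p : V) :
    mvEval p (symbol b Φ) = ∑ J : Fin k → Fin n,
      evalAt K p (Φ fun j => linFun K (b.coord (J j))) • coordVector b J := by
  simp [symbol]

lemma coordVector_comp_perm {m : ℕ} (σ : Equiv.Perm (Fin m)) (I : Fin m → Fin n) :
    coordVector b (fun j => I (σ j)) = (Equiv.Perm.sign σ : ℤ) • coordVector b I := by
  have := (ExteriorAlgebra.ιMulti K m).map_perm (fun j => b (I j)) σ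
  simpa [coordVector, Units.smul_def, Function.comp_def] using this

/-- The alternation in the definition of `L₂` can be left out, because the coordinate multivectors
are alternating. -/
lemma L2_eq_sum [CharZero K] {m : ℕ} (Ψ : Cochain K (Poly K V) (Poly K V) m) (p : V) :
    L2 b Ψ p = ∑ I : Fin m → Fin n,
      evalAt K p (Ψ fun j => shiftedCoord b p (I j)) • coordVector b I := by
  have h1 : ∀ σ : Equiv.Perm (Fin m), ∑ I : Fin m → Fin n, ((Equiv.Perm.sign σ : ℤ) •
      evalAt K p (Ψ fun j => shiftedCoord b p (I (σ j)))) • coordVector b I =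
      ∑ I : Fin m → Fin n,
        evalAt K p (Ψ fun j => shiftedCoord b p (I j)) • coordVector b I := by
    intro σ
    rw [← Equiv.sum_comp (σ.arrowCongr (Equiv.refl (Fin n)))
      (fun I => ((Equiv.Perm.sign σ : ℤ) •
        evalAt K p (Ψ fun j => shiftedCoord b p (I (σ j)))) • coordVector b I)]
    refine Finset.sum_congr rfl fun I _ => ?_
    have h2 : ∀ j, (σ.arrowCongr (Equiv.refl (Fin n))) I (σ j) = I j := fun j => by simp
    have h3 : coordVector b ((σ.arrowCongr (Equiv.refl (Fin n))) I) =
        (Equiv.Perm.sign σ : ℤ) • coordVector b I := by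
      rw [← Equiv.Perm.sign_symm, ← coordVector_comp_perm]; rfl
    simp only [h2, h3, smul_assoc, smul_comm _ (Equiv.Perm.sign σ : ℤ), smul_smul]
    rw [← Units.val_mul, Int.units_mul_self]
    simp
  simp only [L2, Finset.mul_sum, Finset.sum_smul, mul_smul]
  rw [Finset.sum_comm]
  simp only [← Finset.smul_sum, h1, Finset.sum_const, Finset.card_univ, Fintype.card_perm,
    Fintype.card_fin]
  rw [← Nat.cast_smul_eq_nsmul K, smul_smul, inv_mul_cancel₀, one_smul]
  exact_mod_cast m.factorial_ne_zero

end Symbol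

section TwistedComposition

variable {K : Type*} [Field K] {G : Type*} [Group G] {V : Type*} [AddCommGroup V] [Module K V]
  [DistribMulAction G V] [SMulCommClass G K V] {n : ℕ} (b : Basis (Fin n) K V)

lemma evalAt_smul (h : G) (p : V) (f : Poly K V) :
    evalAt K p (h • f) = evalAt K (h⁻¹ • p) f := evalAt_pullback _ _ _

lemma smul_linFun (h : G) (φ : Dual K V) :
    h • linFun K φ = linFun K (φ ∘ₗ actV K V h⁻¹) := pullback_linFun _ _

lemma smul_algebraMap_poly (h : G) (c : K) :
    h • algebraMap K (Poly K V) c = algebraMap K (Poly K V) c :=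
  (pullback (actV K V h⁻¹)).commutes c

lemma differential_smul (h : G) (p : V) (f : Poly K V) :
    differential p (h • f) = differential (h⁻¹ • p) f ∘ₗ actV K V h⁻¹ :=
  differential_pullback _ _ _

/-- The multivector at a fixed point `p` of `β` that belongs to the `β`-twisted composition of `Φ`
and `Ψ` depends only on the symbols of `Φ` and `Ψ`, and not on `β`. -/
theorem sum_twistedArgs_smul_coordVector {k l : ℕ} (β : G) (p : V) (hp : β • p = p)
    (Φ : Cochain K (Poly K V) (Poly K V) k) (Ψ : Cochain K (Poly K V) (Poly K V) l)
    (hΦ : IsFirstOrderAt Φ p) (hΨ : IgnoresConstants Ψ)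
    (hβ : ∀ x y, mvDeriv p x (symbol b Ψ) * ExteriorAlgebra.ι K (β⁻¹ • y) =
      mvDeriv p x (symbol b Ψ) * ExteriorAlgebra.ι K y) :
    ∑ I : Fin (k + l - 1) → Fin n, evalAt K p (∑ s : Fin k, (-1 : K) ^ (s.1 * (l + 1)) •
      Φ (twistedArgs β Ψ s fun j => shiftedCoord b p (I j))) • coordVector b I =
    contractInsert p (mvEval p (symbol b Φ)) (symbol b Ψ) := by
  let φ : MultilinearMap K (fun _ : Fin k => Dual K V) K :=
    (evalAt K p).toLinearMap.compMultilinearMap (Φ.compLinearMap fun _ => linFun K)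
  have hφ : ∀ θ, φ θ = evalAt K p (Φ fun j => linFun K (θ j)) := fun θ => by simp [φ]
  let D : (Fin l → Fin n) → Dual K V := fun J =>
    differential p (Ψ fun j => linFun K (b.coord (J j)))
  have hp' : β⁻¹ • p = p := by rw [inv_smul_eq_iff, hp]
  have h1 : ∀ (s : Fin k) (I : Fin (k + l - 1) → Fin n) (j : Fin k),
      differential p (twistedArgs β Ψ s (fun j => shiftedCoord b p (I j)) j) =
        slotCovector b D (actV K V β⁻¹) s I j := by
    intro s I j
    simp only [twistedArgs, slotCovector, insertArgs, Fin.lt_def]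
    rcases lt_trichotomy j.1 s.1 with h | h | h
    · rw [if_neg h.not_gt, dif_pos h, dif_pos h, shiftedCoord]; simp
    · have h5 : ¬ s.1 < j.1 := by omega
      have h6 : ¬ j.1 < s.1 := by omega
      rw [if_neg h5, dif_neg h6, dif_neg h6, dif_pos h, dif_pos h]
      exact congrArg (differential p) (hΨ _ _)
    · have h5 : ¬ j.1 = s.1 := by omega
      rw [if_pos h, dif_neg h.not_gt, dif_neg h.not_gt, dif_neg h5, dif_neg h5,
        differential_smul, hp', shiftedCoord]
      simp
  have h2 : ∀ (s : Fin k) (I : Fin (k + l - 1) → Fin n),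
      evalAt K p (Φ (twistedArgs β Ψ s fun j => shiftedCoord b p (I j))) =
        φ (slotCovector b D (actV K V β⁻¹) s I) := by
    intro s I
    rw [hΦ, hφ]
    simp only [h1]
  have h3 : ∀ x, ∑ J, D J x • coordVector b J = mvDeriv p x (symbol b Ψ) := fun x => by
    simp [symbol, D]
  simp only [map_sum, map_smul, smul_eq_mul, h2]
  rw [sum_slots_smul_coordVector b φ D (actV K V β⁻¹) (fun x y => by rw [h3]; exact hβ x y),
    mvEval_symbol]
  simp only [symbol, map_sum, contractInsert_tmul, D, hφ]

lemma gerst_eq_sum_twistedArgs {k l : ℕ}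
    (Φ : Cochain K (Poly K V) (Poly K V) k) (Ψ : Cochain K (Poly K V) (Poly K V) l)
    (f : Fin (k + l - 1) → Poly K V) :
    gerst Φ Ψ f =
      ∑ s : Fin k, (-1 : K) ^ (s.1 * (l + 1)) • Φ (twistedArgs (1 : G) Ψ s f) := by
  have h : ∀ s : Fin k, twistedArgs (1 : G) Ψ s f = insertArgs Ψ s f := fun s => by
    funext j; simp [twistedArgs]
  simp only [gerst_apply, h]

end TwistedComposition

/-! ### Multivector fields as cochains -/

section MultivectorOperators

variable {K : Type*} [Field K] {V : Type*} [AddCommGroup V] [Module K V]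

lemma constOp_ιMulti_of_ne {a m : ℕ} (h : m ≠ a) (v : Fin m → V) :
    constOp (K := K) a (ExteriorAlgebra.ιMulti K m v) = 0 := by
  rw [constOp, ExteriorAlgebra.liftAlternating_apply_ιMulti, Pi.single_eq_of_ne h]; rfl

/-- A multidifferential operator with constant coefficients depends only on the first derivatives
of its arguments; `π` is the identity or the evaluation at a point. -/
lemma map_constOp_congr {R : Type*} [CommRing R] [Algebra K R] (π : Poly K V →ₐ[K] R) {a : ℕ}
    (w : ExteriorAlgebra K V) {f f' : Fin a → Poly K V}
    (h : ∀ v j, π (dirDeriv v (f j)) = π (dirDeriv v (f' j))) :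
    π (constOp a w f) = π (constOp a w f') := by
  let F : (Fin a → Poly K V) → ExteriorAlgebra K V →ₗ[K] R := fun f =>
    { toFun := fun w => π (constOp a w f)
      map_add' := by intros; simp
      map_smul' := by intros; simp }
  suffices F f = F f' from LinearMap.congr_fun this w
  refine ExteriorAlgebra.lhom_ext fun m => ?_
  ext v
  change π (constOp a (ExteriorAlgebra.ιMulti K m v) f) =
    π (constOp a (ExteriorAlgebra.ιMulti K m v) f')
  by_cases hm : m = a
  · subst hm
    simp only [constOp_ιMulti, map_smul, map_sum, map_zsmul, map_prod, h]
  · simp [constOp_ιMulti_of_ne hm]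

lemma map_mvOp_congr {R : Type*} [CommRing R] [Algebra K R] (π : Poly K V →ₐ[K] R) {a : ℕ}
    (Y : MVField K V) {f f' : Fin a → Poly K V}
    (h : ∀ v j, π (dirDeriv v (f j)) = π (dirDeriv v (f' j))) :
    π (mvOp a Y f) = π (mvOp a Y f') := by
  induction Y using TensorProduct.induction_on with
  | zero => simp
  | tmul c w => rw [mvOp_tmul, mvOp_tmul, map_mul, map_mul, map_constOp_congr π w h]
  | add Y Z hY hZ => simp only [map_add, add_apply, hY, hZ]

lemma evalAt_dirDeriv_differential (p v : V) (f : Poly K V) :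
    evalAt K p (dirDeriv v f) = evalAt K p (dirDeriv v (linFun K (differential p f))) := by
  rw [← differential_apply, ← differential_apply, differential_linFun]

lemma dirDeriv_affine (v : V) (θ : Dual K V) (c : K) :
    dirDeriv v (linFun K θ - algebraMap K (Poly K V) c) = dirDeriv v (linFun K θ) := by
  rw [map_sub, dirDeriv_algebraMap, sub_zero]

lemma isFirstOrderAt_mvOp (a : ℕ) (Y : MVField K V) (p : V) : IsFirstOrderAt (mvOp a Y) p :=
  fun f => map_mvOp_congr (evalAt K p) Y fun v j => evalAt_dirDeriv_differential p v (f j)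

lemma ignoresConstants_mvOp (a : ℕ) (Y : MVField K V) : IgnoresConstants (mvOp a Y) :=
  fun θ c => map_mvOp_congr (AlgHom.id K _) Y fun v j => by
    simp only [AlgHom.id_apply, dirDeriv_affine]

variable (K V) in
/-- The multivector fields of degree `k`. -/
def homogeneousFields (k : ℕ) : Submodule K (MVField K V) :=
  Submodule.span K {Y | ∃ (c : Poly K V) (v : Fin k → V),
    Y = c ⊗ₜ[K] ExteriorAlgebra.ιMulti K k v}

variable {n : ℕ} (b : Basis (Fin n) K V)

/-- A homogeneous multivector field is recovered from the operator it defines. -/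
lemma symbol_mvOp [CharZero K] {k : ℕ} {Y : MVField K V} (hY : Y ∈ homogeneousFields K V k) :
    symbol b (mvOp k Y) = Y := by
  induction hY using Submodule.span_induction with
  | zero => simp [symbol]
  | add Y Z _ _ hY hZ =>
    conv_rhs => rw [← hY, ← hZ]
    simp only [symbol, map_add, add_apply, add_tmul, Finset.sum_add_distrib]
  | smul r Y _ hY =>
    conv_rhs => rw [← hY]
    simp only [symbol, map_smul, smul_apply, ← smul_tmul', Finset.smul_sum]
  | mem Y hY =>
    obtain ⟨c, v, rfl⟩ := hY
    have h1 : ∀ J : Fin k → Fin n,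
        mvOp k (c ⊗ₜ[K] ExteriorAlgebra.ιMulti K k v) (fun j => linFun K (b.coord (J j))) =
          ((k.factorial : K)⁻¹ * ∑ σ : Equiv.Perm (Fin k), ((Equiv.Perm.sign σ : ℤ) : K) *
            ∏ j, b.coord (J j) (v (σ j))) • c := by
      intro J
      rw [mvOp_tmul, constOp_ιMulti]
      simp only [dirDeriv_linFun, Algebra.smul_def, mul_one, ← map_prod]
      simp only [eq_intCast, map_mul, map_sum, map_intCast]
      ring
    have h2 : ∀ σ : Equiv.Perm (Fin k), ∑ J : Fin k → Fin n,
        (((Equiv.Perm.sign σ : ℤ) : K) * ∏ j, b.coord (J j) (v (σ j))) • coordVector b J =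
        ExteriorAlgebra.ιMulti K k v := by
      intro σ
      simp only [mul_smul, ← Finset.smul_sum]
      rw [sum_prod_coord_smul_coordVector b (fun j => v (σ j))]
      have h3 := (ExteriorAlgebra.ιMulti K k).map_perm v σ
      rw [Function.comp_def] at h3
      rw [h3, Units.smul_def, ← Int.cast_smul_eq_zsmul K, smul_smul, ← Int.cast_mul,
        ← Units.val_mul, Int.units_mul_self]
      simp
    simp only [symbol, h1, smul_tmul, ← tmul_sum]
    congr 1
    simp only [mul_smul, ← Finset.smul_sum, Finset.sum_smul]
    rw [Finset.sum_comm]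
    simp only [← mul_smul, h2, Finset.sum_const, Finset.card_univ, Fintype.card_perm,
      Fintype.card_fin]
    rw [← Nat.cast_smul_eq_nsmul K, smul_smul, inv_mul_cancel₀, one_smul]
    exact_mod_cast k.factorial_ne_zero

lemma sharp_apply {k l : ℕ} (X : Cochain K (Poly K V) (Poly K V) k)
    (Ω : Cochain K (Poly K V) (Poly K V) l) (f : Fin (k + l) → Poly K V) :
    sharp X Ω f = X (fun i => f (Fin.castAdd l i)) * Ω (fun i => f (Fin.natAdd k i)) := by
  simp [sharp]

lemma symbol_sharp {k l : ℕ} (X : Cochain K (Poly K V) (Poly K V) k)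
    (Ω : Cochain K (Poly K V) (Poly K V) l) :
    symbol b (sharp X Ω) = symbol b X * symbol b Ω := by
  rw [symbol, ← Equiv.sum_comp (Fin.appendEquiv k l), Fintype.sum_prod_type, symbol, symbol,
    Finset.sum_mul_sum]
  refine Finset.sum_congr rfl fun I _ => Finset.sum_congr rfl fun J _ => ?_
  have h : Fin.appendEquiv k l (I, J) = Fin.append I J := rfl
  rw [h, coordVector_append, Algebra.TensorProduct.tmul_mul_tmul, sharp_apply]
  simp

end MultivectorOperators

/-! ### The twisted cocycle at fixed points and on affine functions -/

section TwistedCocycleValues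

variable {K : Type*} [Field K] [CharZero K] {G : Type*} [Group G] [Finite G]
  {V : Type*} [AddCommGroup V] [Module K V] [FiniteDimensional K V]
  [DistribMulAction G V] [SMulCommClass G K V]

lemma projNormal_of_mem_fixedSpace {g : G} {p : V} (hp : p ∈ fixedSpace K V g) :
    projNormal K V g p = 0 :=
  (Submodule.projectionOnto_apply_eq_zero_iff _).2 hp

lemma projFixed_of_mem_fixedSpace {g : G} {p : V} (hp : p ∈ fixedSpace K V g) :
    (projFixed K V g p : V) = p := by
  have := Submodule.projectionOnto_apply_left (isCompl_fixed_normal K V g) ⟨p, hp⟩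
  exact congrArg Subtype.val this

lemma projFixed_of_mem_normalSpace {g : G} {p : V} (hp : p ∈ normalSpace K V g) :
    projFixed K V g p = 0 :=
  (Submodule.projectionOnto_apply_eq_zero_iff _).2 hp

variable {g : G} (e : Basis (Fin (codim K V g)) K (normalSpace K V g))

lemma normalCoord_of_mem_fixedSpace {p : V} (hp : p ∈ fixedSpace K V g)
    (i : Fin (codim K V g)) : normalCoord e i p = 0 := by
  simp [normalCoord, projNormal_of_mem_fixedSpace hp]

lemma movedCoord_of_mem_fixedSpace {p : V} (hp : p ∈ fixedSpace K V g)
    (i : Fin (codim K V g)) : movedCoord e i p = 0 := by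
  have h : g⁻¹ • p = p := by rw [inv_smul_eq_iff, (mem_fixedSpace K).1 hp]
  simp [movedCoord, h, normalCoord_of_mem_fixedSpace e hp]

lemma zPoint_of_mem_fixedSpace {p : V} (hp : p ∈ fixedSpace K V g)
    (σ : Equiv.Perm (Fin (codim K V g))) (m : ℕ) : zPoint e σ m p = p := by
  have h : ∀ i, (if (σ.symm i).1 < m then movedCoord e i else normalCoord e i) p = 0 := by
    intro i
    split_ifs
    · exact movedCoord_of_mem_fixedSpace e hp i
    · exact normalCoord_of_mem_fixedSpace e hp i
  simp [zPoint, projFixed_of_mem_fixedSpace hp, h]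

lemma denom_mul_diffQuot (σ : Equiv.Perm (Fin (codim K V g))) (j : Fin (codim K V g))
    (f : Poly K V) : denom e (σ j) * diffQuot e σ j f =
      pullback (zPoint e σ j.1) f - pullback (zPoint e σ (j.1 + 1)) f :=
  mul_exactDiv _ _ _ _ _

/-- At a fixed point of `g` the difference quotients are directional derivatives: differentiate the
defining equation of the quotient in a direction in which its denominator does not vanish. -/
lemma evalAt_diffQuot {p : V} (hp : p ∈ fixedSpace K V g)
    (σ : Equiv.Perm (Fin (codim K V g))) (j : Fin (codim K V g)) (f : Poly K V) :
    evalAt K p (diffQuot e σ j f) = evalAt K p (dirDeriv (e (σ j) : V) f) := by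
  set δ : Dual K V := normalCoord e (σ j) - movedCoord e (σ j) with hδ
  have hδ0 : δ ≠ 0 := by
    intro h
    apply denom_ne_zero e (σ j)
    rw [denom, ← hδ, h, map_zero]
  obtain ⟨u, hu⟩ : ∃ u, δ u ≠ 0 := by
    by_contra! h
    exact hδ0 (LinearMap.ext h)
  have hδp : δ p = 0 := by
    simp [hδ, normalCoord_of_mem_fixedSpace e hp, movedCoord_of_mem_fixedSpace e hp]
  have hS : zPoint e σ j.1 u - zPoint e σ (j.1 + 1) u = δ u • (e (σ j) : V) := by
    have := LinearMap.congr_fun (zPoint_sub e σ j) u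
    simpa [hδ] using this
  have h1 := congrArg (fun f => evalAt K p (dirDeriv u f)) (denom_mul_diffQuot e σ j f)
  simp only [dirDeriv_mul, map_sub, map_add, map_mul, dirDeriv_pullback, evalAt_pullback,
    zPoint_of_mem_fixedSpace e hp] at h1
  -- Only the term with the derivative of the denominator is left, as `δ` vanishes at `p`.
  rw [← map_sub, ← LinearMap.sub_apply, ← map_sub, hS, denom, ← hδ, dirDeriv_linFun,
    evalAt_linFun, hδp, map_smul] at h1
  simp only [map_smul, LinearMap.smul_apply, map_one, zero_mul, zero_add, smul_eq_mul,
    mul_one] at h1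
  rw [mul_comm] at h1
  exact mul_left_cancel₀ hu h1

lemma diffQuot_affine (σ : Equiv.Perm (Fin (codim K V g))) (j : Fin (codim K V g))
    (θ : Dual K V) (c : K) :
    diffQuot e σ j (linFun K θ - algebraMap K _ c) =
      dirDeriv (e (σ j) : V) (linFun K θ - algebraMap K _ c) := by
  apply mul_left_cancel₀ (denom_ne_zero e (σ j))
  rw [denom_mul_diffQuot, dirDeriv_affine, dirDeriv_linFun, map_sub, map_sub, AlgHom.commutes,
    AlgHom.commutes, sub_sub_sub_cancel_right, pullback_linFun, pullback_linFun, ← map_sub,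
    ← LinearMap.comp_sub, zPoint_sub, mul_smul_comm, mul_one, denom, ← map_smul]
  congr 1
  ext x
  simp [mul_comm]

/-- The constant multivector `Λ_g = ∂/∂y¹ ∧ ⋯ ∧ ∂/∂y^{l(g)}`. -/
def normalVolume : ExteriorAlgebra K V :=
  ExteriorAlgebra.ιMulti K (codim K V g) fun i => (e i : V)

lemma map_twistedCocycle {R : Type*} [CommRing R] [Algebra K R] (π : Poly K V →ₐ[K] R)
    (f : Fin (codim K V g) → Poly K V)
    (h : ∀ σ j, π (diffQuot e σ j (f j)) = π (dirDeriv (e (σ j) : V) (f j))) :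
    π (twistedCocycle e f) = π (mvOp (codim K V g) (1 ⊗ₜ[K] normalVolume e) f) := by
  rw [mvOp_tmul, one_mul, normalVolume, constOp_ιMulti]
  simp only [twistedCocycle, smul_apply, sum_apply, MultilinearMap.compLinearMap_apply,
    MultilinearMap.mkPiAlgebra_apply, map_smul, map_sum, map_zsmul, map_prod, h]

lemma evalAt_twistedCocycle {p : V} (hp : p ∈ fixedSpace K V g)
    (f : Fin (codim K V g) → Poly K V) :
    evalAt K p (twistedCocycle e f) =
      evalAt K p (mvOp (codim K V g) (1 ⊗ₜ[K] normalVolume e) f) :=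
  map_twistedCocycle e (evalAt K p) f fun σ j => evalAt_diffQuot e hp σ j (f j)

lemma twistedCocycle_affine (θ : Fin (codim K V g) → Dual K V) (c : Fin (codim K V g) → K) :
    twistedCocycle e (fun j => linFun K (θ j) - algebraMap K _ (c j)) =
      mvOp (codim K V g) (1 ⊗ₜ[K] normalVolume e)
        (fun j => linFun K (θ j) - algebraMap K _ (c j)) :=
  map_twistedCocycle e (AlgHom.id K _) _ fun σ j => diffQuot_affine e σ j (θ j) (c j)

lemma twistedCocycle_linFun (θ : Fin (codim K V g) → Dual K V) :
    twistedCocycle e (fun j => linFun K (θ j)) =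
      mvOp (codim K V g) (1 ⊗ₜ[K] normalVolume e) (fun j => linFun K (θ j)) := by
  simpa using twistedCocycle_affine e θ 0

lemma isFirstOrderAt_twistedCocycle {p : V} (hp : p ∈ fixedSpace K V g) :
    IsFirstOrderAt (twistedCocycle e) p := fun f => by
  rw [evalAt_twistedCocycle e hp, isFirstOrderAt_mvOp, ← evalAt_twistedCocycle e hp]

lemma ignoresConstants_twistedCocycle : IgnoresConstants (twistedCocycle e) := fun θ c => by
  rw [twistedCocycle_affine, ignoresConstants_mvOp, twistedCocycle_linFun]

variable {n : ℕ} (b : Basis (Fin n) K V)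

lemma symbol_twistedCocycle : symbol b (twistedCocycle e) = 1 ⊗ₜ[K] normalVolume e := by
  have h : symbol b (twistedCocycle e) =
      symbol b (mvOp (codim K V g) (1 ⊗ₜ[K] normalVolume e)) := by
    simp only [symbol, twistedCocycle_linFun]
  rw [h]
  exact symbol_mvOp b (Submodule.subset_span ⟨1, _, rfl⟩)

end TwistedCocycleValues

/-! ### Twisted multivector fields and their cochains -/

section TwistedFieldSymbols

variable {K : Type*} [Field K] {G : Type*} [Group G]
  {V : Type*} [AddCommGroup V] [Module K V] [DistribMulAction G V] [SMulCommClass G K V]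

/-- Sections of `∧^{k - l(g)} TV^g ⊗ ∧^{l(g)} N^g` are sums of decomposable ones. -/
lemma twistedFields_induction {g : G} {k : ℕ} {p : TwistedField K V g → Prop}
    (pure : ∀ (a : ℕ) (_ : a + codim K V g = k) (c : Poly K (fixedSpace K V g))
      (u : Fin a → fixedSpace K V g) (w : Fin (codim K V g) → normalSpace K V g),
      p (c ⊗ₜ[K] (ExteriorAlgebra.ιMulti K a u ⊗ₜ[K] ExteriorAlgebra.ιMulti K _ w)))
    (zero : p 0) (add : ∀ x y, p x → p y → p (x + y)) (smul : ∀ (r : K) x, p x → p (r • x))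
    {ξ : TwistedField K V g} (hξ : ξ ∈ twistedFields K V g k) : p ξ := by
  let S : Submodule K (TwistedField K V g) := Submodule.span K
    {ζ | ∃ (a : ℕ) (_ : a + codim K V g = k) (c : Poly K (fixedSpace K V g))
      (u : Fin a → fixedSpace K V g) (w : Fin (codim K V g) → normalSpace K V g),
      ζ = c ⊗ₜ[K] (ExteriorAlgebra.ιMulti K a u ⊗ₜ[K] ExteriorAlgebra.ιMulti K _ w)}
  have hS : twistedFields K V g k ≤ S := by
    refine iSup₂_le fun a ha => ?_
    rintro _ ⟨z, rfl⟩
    induction z using TensorProduct.induction_on with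
    | zero => simp
    | add x y hx hy => rw [map_add]; exact S.add_mem hx hy
    | tmul c z =>
      induction z using TensorProduct.induction_on with
      | zero => simp
      | add x y hx hy => rw [tmul_add, map_add]; exact S.add_mem hx hy
      | tmul u w =>
        obtain ⟨u, hu⟩ := u
        obtain ⟨w, hw⟩ := w
        simp only [LinearMap.lTensor_tmul, TensorProduct.map_tmul, Submodule.subtype_apply]
        rw [← ExteriorAlgebra.ιMulti_span_fixedDegree] at hu hw
        induction hu using Submodule.span_induction with
        | zero => simp
        | add x y _ _ hx hy => rw [add_tmul, tmul_add]; exact S.add_mem hx hy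
        | smul r x _ hx => rw [← smul_tmul', tmul_smul]; exact S.smul_mem _ hx
        | mem x hx =>
          obtain ⟨u, rfl⟩ := hx
          induction hw using Submodule.span_induction with
          | zero => simp
          | add x y _ _ hx hy => rw [tmul_add, tmul_add]; exact S.add_mem hx hy
          | smul r x _ hx => rw [tmul_smul, tmul_smul]; exact S.smul_mem _ hx
          | mem x hx =>
            obtain ⟨w, rfl⟩ := hx
            exact Submodule.subset_span ⟨a, ha, c, u, w, rfl⟩
  have h := hS hξ
  clear hξ
  induction h using Submodule.span_induction with
  | zero => exact zero
  | add x y _ _ hx hy => exact add x y hx hy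
  | smul r x _ hx => exact smul r x hx
  | mem x hx =>
    obtain ⟨a, ha, c, u, w, rfl⟩ := hx
    exact pure a ha c u w

variable [CharZero K] [Finite G] [FiniteDimensional K V]

lemma extend_tmul {g : G} {a : ℕ} (c : Poly K (fixedSpace K V g))
    (u : Fin a → fixedSpace K V g) (w : Fin (codim K V g) → normalSpace K V g) :
    extend g (c ⊗ₜ[K] (ExteriorAlgebra.ιMulti K a u ⊗ₜ[K] ExteriorAlgebra.ιMulti K _ w)) =
      pullback (projFixed K V g) c ⊗ₜ[K]
        (ExteriorAlgebra.ιMulti K a (fun i => (u i : V)) *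
          ExteriorAlgebra.ιMulti K _ fun i => (w i : V)) := by
  simp [extend, ExteriorAlgebra.map_apply_ιMulti, Function.comp_def]

lemma extend_mem_homogeneousFields {g : G} {k : ℕ} {ξ : TwistedField K V g}
    (hξ : ξ ∈ twistedFields K V g k) : extend g ξ ∈ homogeneousFields K V k := by
  refine twistedFields_induction
    (p := fun ξ => extend g ξ ∈ homogeneousFields K V k)
    ?_ ?_ ?_ ?_ hξ
  · rintro a rfl c u w
    rw [extend_tmul, ExteriorAlgebra.ιMulti_mul_ιMulti]
    exact Submodule.subset_span ⟨_, _, rfl⟩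
  · simp
  · intro x y hx hy; rw [map_add]; exact add_mem hx hy
  · intro r x hx; rw [map_smul]; exact Submodule.smul_mem _ _ hx

lemma ιMulti_mul_ι_of_mem_normalSpace {g : G} (w : Fin (codim K V g) → normalSpace K V g) {y : V}
    (hy : y ∈ normalSpace K V g) :
    (ExteriorAlgebra.ιMulti K _ fun i => (w i : V)) * ExteriorAlgebra.ι K y = 0 := by
  have h1 : ExteriorAlgebra.ι K y = ExteriorAlgebra.ιMulti K 1 fun _ => y := by
    simp [ExteriorAlgebra.ιMulti_apply]
  rw [h1, ExteriorAlgebra.ιMulti_mul_ιMulti]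
  apply AlternatingMap.map_linearDependent
  -- These are `l(g) + 1` vectors of the space `N^g` of dimension `l(g)`.
  intro h
  have h2 : ∀ i, Fin.append (fun i => (w i : V)) (fun _ : Fin 1 => y) i ∈ normalSpace K V g :=
    fun i => Fin.addCases (fun i => by simp) (fun i => by simpa using hy) i
  have h3 : LinearIndependent K (fun i => (⟨_, h2 i⟩ : normalSpace K V g)) :=
    LinearIndependent.of_comp (normalSpace K V g).subtype h
  have := h3.fintype_card_le_finrank
  rw [Fintype.card_fin] at this
  simp [codim] at this

/-- The coefficients of a twisted field, and of its derivatives, are annihilated by the vectors of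
`N^g`, because they are multiples of a generator of `∧^{l(g)} N^g`. -/
lemma mvDeriv_extend_mul_ι {g : G} {k : ℕ} {ξ : TwistedField K V g}
    (hξ : ξ ∈ twistedFields K V g k) (p v : V) {y : V} (hy : y ∈ normalSpace K V g) :
    mvDeriv p v (extend g ξ) * ExteriorAlgebra.ι K y = 0 := by
  refine twistedFields_induction
    (p := fun ξ => mvDeriv p v (extend g ξ) * ExteriorAlgebra.ι K y = 0)
    ?_ ?_ ?_ ?_ hξ
  · rintro a rfl c u w
    rw [extend_tmul, mvDeriv_tmul, smul_mul_assoc, mul_assoc, ιMulti_mul_ι_of_mem_normalSpace w hy]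
    simp
  · simp
  · intro x y hx hy; rw [map_add, map_add, add_mul, hx, hy, add_zero]
  · intro r x hx; rw [map_smul, map_smul, smul_mul_assoc, hx, smul_zero]

lemma inv_smul_sub_mem_normalSpace (g : G) (y : V) : g⁻¹ • y - y ∈ normalSpace K V g :=
  ⟨-(g⁻¹ • y), by simp [neg_add_eq_sub]⟩

lemma mvEval_extend_projFixed (g : G) (ξ : TwistedField K V g) (x : V) :
    mvEval (projFixed K V g x : V) (extend g ξ) = mvEval x (extend g ξ) := by
  induction ξ using TensorProduct.induction_on with
  | zero => simp
  | add x y hx hy => simp only [map_add, hx, hy]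
  | tmul c w =>
    have h : projFixed K V g (projFixed K V g x : V) = projFixed K V g x :=
      Subtype.ext (projFixed_of_mem_fixedSpace (projFixed K V g x).2)
    simp [extend, h]

lemma projFixed_smul (g h : G) (x : V) :
    (projFixed K V (h * g * h⁻¹) (h • x) : V) = h • (projFixed K V g x : V) := by
  have h1 : x - projFixed K V g x ∈ normalSpace K V g := by
    have : projFixed K V g (x - projFixed K V g x) = 0 := by
      rw [map_sub, sub_eq_zero]
      exact Subtype.ext (projFixed_of_mem_fixedSpace (projFixed K V g x).2).symm
    exact (Submodule.projectionOnto_apply_eq_zero_iff _).1 this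
  have h2 : h • (x - projFixed K V g x) ∈ normalSpace K V (h * g * h⁻¹) := by
    obtain ⟨v, hv⟩ := h1
    refine ⟨h • v, ?_⟩
    rw [← hv]
    simp [mul_smul, smul_sub]
  have h3 : h • x = h • (projFixed K V g x : V) + h • (x - projFixed K V g x) := by
    rw [← smul_add]; simp
  rw [h3, map_add, projFixed_of_mem_normalSpace h2, add_zero,
    projFixed_of_mem_fixedSpace (smul_mem_fixedSpace K h (projFixed K V g x).2)]

/-- The invariance of a field, extended from the fixed spaces to all of `V`. -/
lemma IsInvariantField.mvEval_smul {k : ℕ} {ξ : ∀ g : G, TwistedField K V g}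
    (hξ : IsInvariantField k ξ) (h g : G) (x : V) :
    mvEval (h • x) (extend (h * g * h⁻¹) (ξ (h * g * h⁻¹))) =
      ExteriorAlgebra.map (actV K V h) (mvEval x (extend g (ξ g))) := by
  rw [← mvEval_extend_projFixed, projFixed_smul, hξ.invariant h g _ (projFixed K V g x).2,
    mvEval_extend_projFixed]

variable {g : G} (e : Basis (Fin (codim K V g)) K (normalSpace K V g))

lemma fixedPart_tmul {a : ℕ} (c : Poly K (fixedSpace K V g))
    (u : Fin a → fixedSpace K V g) (w : Fin (codim K V g) → normalSpace K V g) :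
    fixedPart e (c ⊗ₜ[K] (ExteriorAlgebra.ιMulti K a u ⊗ₜ[K] ExteriorAlgebra.ιMulti K _ w)) =
      pullback (projFixed K V g) c ⊗ₜ[K]
        (e.det w • ExteriorAlgebra.ιMulti K a fun i => (u i : V)) := by
  simp [fixedPart, ExteriorAlgebra.map_apply_ιMulti, Function.comp_def,
    ExteriorAlgebra.liftAlternating_apply_ιMulti]

lemma ιMulti_normal_eq_det_smul (w : Fin (codim K V g) → normalSpace K V g) :
    (ExteriorAlgebra.ιMulti K _ fun i => (w i : V)) = e.det w • normalVolume e := by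
  let F : normalSpace K V g [⋀^Fin (codim K V g)]→ₗ[K] ExteriorAlgebra K V :=
    (ExteriorAlgebra.ιMulti K (codim K V g)).compLinearMap (normalSpace K V g).subtype
  let F' : normalSpace K V g [⋀^Fin (codim K V g)]→ₗ[K] ExteriorAlgebra K V :=
    (LinearMap.toSpanSingleton K _ (normalVolume e)).compAlternatingMap e.det
  suffices F = F' from DFunLike.congr_fun this w
  refine Basis.ext_alternating e fun v hv => ?_
  obtain ⟨σ, rfl⟩ : ∃ σ : Equiv.Perm (Fin (codim K V g)), v = σ :=
    ⟨Equiv.ofBijective v (Finite.injective_iff_bijective.1 hv), rfl⟩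
  have h1 := F.map_perm (fun i => e i) σ
  have h2 := F'.map_perm (fun i => e i) σ
  simp only [Function.comp_def] at h1 h2
  rw [h1, h2]
  congr 1
  simp [F, F', normalVolume, Basis.det_self]

lemma fixedPart_mem_homogeneousFields {k : ℕ} {ξ : TwistedField K V g}
    (hξ : ξ ∈ twistedFields K V g k) :
    fixedPart e ξ ∈ homogeneousFields K V (k - codim K V g) := by
  refine twistedFields_induction
    (p := fun ξ => fixedPart e ξ ∈ homogeneousFields K V (k - codim K V g))
    ?_ ?_ ?_ ?_ hξ
  · rintro a rfl c u w
    rw [fixedPart_tmul, tmul_smul, Nat.add_sub_cancel]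
    exact Submodule.smul_mem _ _ (Submodule.subset_span ⟨_, _, rfl⟩)
  · simp
  · intro x y hx hy; rw [map_add]; exact add_mem hx hy
  · intro r x hx; rw [map_smul]; exact Submodule.smul_mem _ _ hx

/-- Writing `ξ = X ⊗ Λ_g` and wedging `X` with `Λ_g` gives `ξ` back, for every choice of basis. -/
lemma fixedPart_mul_normalVolume {k : ℕ} {ξ : TwistedField K V g}
    (hξ : ξ ∈ twistedFields K V g k) :
    fixedPart e ξ * (1 ⊗ₜ[K] normalVolume e) = extend g ξ := by
  refine twistedFields_induction
    (p := fun ξ => fixedPart e ξ * (1 ⊗ₜ[K] normalVolume e) = extend g ξ)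
    ?_ ?_ ?_ ?_ hξ
  · rintro a rfl c u w
    rw [fixedPart_tmul, extend_tmul, Algebra.TensorProduct.tmul_mul_tmul, mul_one,
      ιMulti_normal_eq_det_smul e w, smul_mul_assoc, mul_smul_comm]
  · simp
  · intro x y hx hy; rw [map_add, map_add, add_mul, hx, hy]
  · intro r x hx; rw [map_smul, map_smul, smul_mul_assoc, hx]

lemma T1Component_apply {k : ℕ} (h : codim K V g ≤ k) (ξ : TwistedField K V g)
    (f : Fin k → Poly K V) :
    T1Component e k ξ f = mvOp (k - codim K V g) (fixedPart e ξ)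
        (fun i => f (Fin.cast (Nat.sub_add_cancel h) (Fin.castAdd _ i))) *
      twistedCocycle e (fun i => f (Fin.cast (Nat.sub_add_cancel h) (Fin.natAdd _ i))) := by
  rw [T1Component, dif_pos h, MultilinearMap.domDomCongr_apply, sharp_apply]
  rfl

lemma isFirstOrderAt_T1Component (k : ℕ) (ξ : TwistedField K V g) {p : V}
    (hp : p ∈ fixedSpace K V g) : IsFirstOrderAt (T1Component e k ξ) p := by
  intro f
  by_cases h : codim K V g ≤ k
  · rw [T1Component_apply e h, T1Component_apply e h, map_mul, map_mul, isFirstOrderAt_mvOp,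
      isFirstOrderAt_twistedCocycle e hp]
  · simp [T1Component, h]

lemma ignoresConstants_T1Component (k : ℕ) (ξ : TwistedField K V g) :
    IgnoresConstants (T1Component e k ξ) := by
  intro θ c
  by_cases h : codim K V g ≤ k
  · rw [T1Component_apply e h, T1Component_apply e h]
    exact congrArg₂ _ (ignoresConstants_mvOp _ _ _ _) (ignoresConstants_twistedCocycle e _ _)
  · simp [T1Component, h]

lemma eq_zero_of_not_codim_le {k : ℕ} {ξ : TwistedField K V g} (hξ : ξ ∈ twistedFields K V g k)
    (h : ¬ codim K V g ≤ k) : ξ = 0 := by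
  refine twistedFields_induction (p := fun ξ => ξ = 0) ?_ rfl ?_ ?_ hξ
  · intro a ha; omega
  · rintro x y rfl rfl; simp
  · rintro r x rfl; simp

lemma symbol_domDomCongr_finCongr {n : ℕ} (b : Basis (Fin n) K V) {k l : ℕ} (h : k = l)
    (Φ : Cochain K (Poly K V) (Poly K V) k) :
    symbol b (Φ.domDomCongr (finCongr h)) = symbol b Φ := by
  subst h; rfl

/-- The symbol of `T₁^g(ξ)` is the multivector field `ξ`. -/
lemma symbol_T1Component {n : ℕ} (b : Basis (Fin n) K V) {k : ℕ} {ξ : TwistedField K V g}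
    (hξ : ξ ∈ twistedFields K V g k) : symbol b (T1Component e k ξ) = extend g ξ := by
  by_cases h : codim K V g ≤ k
  · rw [T1Component, dif_pos h, symbol_domDomCongr_finCongr, symbol_sharp,
      symbol_mvOp b (fixedPart_mem_homogeneousFields e hξ), symbol_twistedCocycle,
      fixedPart_mul_normalVolume e hξ]
  · rw [eq_zero_of_not_codim_le hξ h, T1Component, dif_neg h]
    simp [symbol]

end TwistedFieldSymbols

/-! ### The components of `T₁(ξ)` -/

section AveragedComponents

variable {K : Type*} [Field K] {G : Type*} [Group G]
  {V : Type*} [AddCommGroup V] [Module K V] [DistribMulAction G V] [SMulCommClass G K V]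

/-- The cochain `f ↦ h⁻¹ Φ(h f₁, …, h f_k)` on `Poly(V)`. -/
def translate (h : G) {k : ℕ} (Φ : Cochain K (Poly K V) (Poly K V) k) :
    Cochain K (Poly K V) (Poly K V) k :=
  (DistribSMul.toLinearMap K (Poly K V) h⁻¹).compMultilinearMap
    (Φ.compLinearMap fun _ => DistribSMul.toLinearMap K (Poly K V) h)

lemma translate_apply (h : G) {k : ℕ} (Φ : Cochain K (Poly K V) (Poly K V) k)
    (f : Fin k → Poly K V) : translate h Φ f = h⁻¹ • Φ (fun i => h • f i) := by
  simp [translate]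

lemma evalAt_translate (h : G) {k : ℕ} (Φ : Cochain K (Poly K V) (Poly K V) k)
    (f : Fin k → Poly K V) (p : V) :
    evalAt K p (translate h Φ f) = evalAt K (h • p) (Φ fun i => h • f i) := by
  rw [translate_apply, evalAt_smul, inv_inv]

lemma isFirstOrderAt_translate (h : G) {k : ℕ} {Φ : Cochain K (Poly K V) (Poly K V) k} {p : V}
    (hΦ : IsFirstOrderAt Φ (h • p)) : IsFirstOrderAt (translate h Φ) p := by
  intro f
  rw [evalAt_translate, evalAt_translate, hΦ]
  simp only [differential_smul, inv_smul_smul, smul_linFun]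

lemma ignoresConstants_translate (h : G) {k : ℕ} {Φ : Cochain K (Poly K V) (Poly K V) k}
    (hΦ : IgnoresConstants Φ) : IgnoresConstants (translate h Φ) := by
  intro θ c
  rw [translate_apply, translate_apply]
  simp only [smul_sub, smul_linFun, smul_algebraMap_poly]
  rw [hΦ]

/-- The translate of a basis by a group element. -/
def smulBasis {n : ℕ} (b : Basis (Fin n) K V) (h : G) : Basis (Fin n) K V :=
  b.map (DistribMulAction.toLinearEquiv K V h)

lemma smulBasis_coord {n : ℕ} (b : Basis (Fin n) K V) (h : G) (i : Fin n) :
    (smulBasis b h).coord i = b.coord i ∘ₗ actV K V h⁻¹ := rfl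

lemma mvEval_symbol_translate {n : ℕ} (b : Basis (Fin n) K V) (h : G) {k : ℕ}
    (Φ : Cochain K (Poly K V) (Poly K V) k) (p : V) :
    ExteriorAlgebra.map (actV K V h) (mvEval p (symbol b (translate h Φ))) =
      mvEval (h • p) (symbol (smulBasis b h) Φ) := by
  rw [mvEval_symbol, mvEval_symbol, map_sum]
  refine Finset.sum_congr rfl fun J _ => ?_
  rw [map_smul, evalAt_translate, coordVector, coordVector, ExteriorAlgebra.map_apply_ιMulti]
  simp only [smul_linFun, smulBasis_coord]
  rfl

lemma map_actV_injective (h : G) :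
    Function.Injective (ExteriorAlgebra.map (actV K V h)) := by
  refine Function.LeftInverse.injective (g := ExteriorAlgebra.map (actV K V h⁻¹)) fun u => ?_
  have : (actV K V h⁻¹) ∘ₗ (actV K V h) = LinearMap.id := by ext v; simp
  rw [← AlgHom.comp_apply, ExteriorAlgebra.map_comp_map, this, ExteriorAlgebra.map_id]
  rfl

variable {n : ℕ} (b : Basis (Fin n) K V)

lemma isFirstOrderAt_smul_sum {ι : Type*} (r : K) (t : Finset ι) {k : ℕ}
    {Φ : ι → Cochain K (Poly K V) (Poly K V) k} {p : V} (h : ∀ i, IsFirstOrderAt (Φ i) p) :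
    IsFirstOrderAt (r • ∑ i ∈ t, Φ i) p := by
  intro f
  simp only [smul_apply, sum_apply, map_smul, map_sum]
  rw [Finset.sum_congr rfl fun i _ => h i f]

lemma ignoresConstants_smul_sum {ι : Type*} (r : K) (t : Finset ι) {k : ℕ}
    {Φ : ι → Cochain K (Poly K V) (Poly K V) k} (h : ∀ i, IgnoresConstants (Φ i)) :
    IgnoresConstants (r • ∑ i ∈ t, Φ i) := by
  intro θ c
  simp only [smul_apply, sum_apply]
  rw [Finset.sum_congr rfl fun i _ => h i θ c]

lemma symbol_smul_sum {ι : Type*} (r : K) (t : Finset ι) {k : ℕ}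
    (Φ : ι → Cochain K (Poly K V) (Poly K V) k) :
    symbol b (r • ∑ i ∈ t, Φ i) = r • ∑ i ∈ t, symbol b (Φ i) := by
  simp only [symbol, smul_apply, sum_apply, sum_tmul, ← smul_tmul', ← Finset.smul_sum]
  rw [Finset.sum_comm]

variable [CharZero K] [Fintype G] [FiniteDimensional K V]
variable (e : ∀ g : G, Basis (Fin (codim K V g)) K (normalSpace K V g))

lemma component_T1 (k : ℕ) (ξ : ∀ g : G, TwistedField K V g) (α : G) :
    component K α (T1 e k ξ) = (Fintype.card G : K)⁻¹ • ∑ h : G,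
      translate h (T1Component (e (h * α * h⁻¹)) k (ξ (h * α * h⁻¹))) := by
  classical
  ext1 f
  simp only [component_apply, T1, average, smul_apply, sum_apply, map_smul, map_sum,
    conjCochain_apply, ofComponent_apply, innerConj_inclAt, coeffAt_inclAt, translate_apply]
  congr 1
  refine Finset.sum_congr rfl fun h _ => ?_
  rw [Finset.sum_eq_single (h * α * h⁻¹)]
  · rw [if_pos (by group)]
  · intro g _ hg
    rw [if_neg]
    rintro rfl
    exact hg (by group)
  · simp

lemma isFirstOrderAt_component_T1 (k : ℕ) (ξ : ∀ g : G, TwistedField K V g) {α : G} {p : V}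
    (hp : p ∈ fixedSpace K V α) : IsFirstOrderAt (component K α (T1 e k ξ)) p := by
  rw [component_T1]
  exact isFirstOrderAt_smul_sum _ _ fun h => isFirstOrderAt_translate h <|
    isFirstOrderAt_T1Component _ _ _ (smul_mem_fixedSpace K h hp)

lemma ignoresConstants_component_T1 (k : ℕ) (ξ : ∀ g : G, TwistedField K V g) (α : G) :
    IgnoresConstants (component K α (T1 e k ξ)) := by
  rw [component_T1]
  exact ignoresConstants_smul_sum _ _ fun h => ignoresConstants_translate h <|
    ignoresConstants_T1Component _ _ _

/-- The average over `G` in `T₁` changes the bases used for the cocycles `Ω_g`, but the symbol of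
each term is `ξ_α`, since `ξ` is invariant. -/
lemma symbol_component_T1 {k : ℕ} {ξ : ∀ g : G, TwistedField K V g}
    (hξ : IsInvariantField k ξ) (α : G) :
    symbol b (component K α (T1 e k ξ)) = extend α (ξ α) := by
  have h1 : ∀ h : G, symbol b
      (translate h (T1Component (e (h * α * h⁻¹)) k (ξ (h * α * h⁻¹)))) = extend α (ξ α) := by
    intro h
    refine mvField_ext b fun x => map_actV_injective h ?_
    rw [mvEval_symbol_translate, symbol_T1Component _ _ (hξ.mem _), hξ.mvEval_smul]
  rw [component_T1, symbol_smul_sum]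
  simp only [h1, Finset.sum_const, Finset.card_univ]
  rw [← Nat.cast_smul_eq_nsmul K, smul_smul, inv_mul_cancel₀, one_smul]
  exact_mod_cast Fintype.card_ne_zero

/-- At a common fixed point of `α` and `β` the multivector of `T(ξ)_α ∘ T(η)_β` is the pre-Lie
product of `ξ_α` and `η_β`. -/
theorem L2_component_gerst_TPart {k l : ℕ} {ξ η : ∀ g : G, TwistedField K V g}
    (hξ : IsInvariantField k ξ) (hη : IsInvariantField l η) {α β : G} {p : V}
    (hα : p ∈ fixedSpace K V α) (hβ : p ∈ fixedSpace K V β) :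
    L2 b (component K (α * β) (restrictPoly K (gerst (TPart e k ξ α) (TPart e l η β)))) p =
      preLie b k l (extend α (ξ α)) (extend β (η β)) p := by
  classical
  have hξs := symbol_component_T1 b e hξ α
  have hηs := symbol_component_T1 b e hη β
  have hξm := symbol_mvOp b (extend_mem_homogeneousFields (hξ.mem α))
  have hηm := symbol_mvOp b (extend_mem_homogeneousFields (hη.mem β))
  have hann : ∀ x y, mvDeriv p x (extend β (η β)) * ExteriorAlgebra.ι K (β⁻¹ • y) =
      mvDeriv p x (extend β (η β)) * ExteriorAlgebra.ι K y := by
    intro x y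
    rw [← sub_eq_zero, ← mul_sub, ← map_sub]
    exact mvDeriv_extend_mul_ι (hη.mem β) p x (inv_smul_sub_mem_normalSpace β y)
  have hleft := sum_twistedArgs_smul_coordVector b β p ((mem_fixedSpace K).1 hβ) _ _
    (isFirstOrderAt_component_T1 e k ξ hα) (ignoresConstants_component_T1 e l η β)
    (by rw [hηs]; exact hann)
  have hright := sum_twistedArgs_smul_coordVector b (1 : G) p (one_smul G p) _ _
    (isFirstOrderAt_mvOp k (extend α (ξ α)) p) (ignoresConstants_mvOp l (extend β (η β)))
    (by simp)
  rw [hξs, hηs] at hleft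
  rw [hξm, hηm] at hright
  rw [L2_eq_sum, preLie]
  simp only [TPart, component_restrictPoly_gerst, if_true]
  rw [hleft, ← hright]
  simp only [gerst_eq_sum_twistedArgs (G := G)]

end AveragedComponents

end OrbifoldHochschild

open OrbifoldHochschild in
theorem mainTheorem2 {K : Type*} [Field K] [CharZero K] {G : Type*} [Group G] [Fintype G]
    {V : Type*} [AddCommGroup V] [Module K V] [FiniteDimensional K V]
    [DistribMulAction G V] [SMulCommClass G K V]
    {n : ℕ} (b : Module.Basis (Fin n) K V)
    (e : ∀ g : G, Module.Basis (Fin (codim K V g)) K (normalSpace K V g))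
    (k l : ℕ) (ξ η : ∀ g : G, TwistedField K V g)
    (hξ : IsInvariantField k ξ) (hη : IsInvariantField l η) :
    (∀ (g : G) (x : fixedSpace K V g),
      L b g (gerst (T e k ξ) (T e l η)) x =
        ∑ α : G, contribution e b k l ξ η α (α⁻¹ * g)
          ⟨x, by rw [mul_inv_cancel_left]; exact x.2⟩) ∧
    (∀ α β : G, fixedSpace K V α ⊓ fixedSpace K V β = fixedSpace K V (α * β) →
      ∀ x : fixedSpace K V (α * β),
        contribution e b k l ξ η α β x =
          pr K V (α * β) (preLie b k l (extend α (ξ α)) (extend β (η β)) x)) := by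
  refine ⟨fun g x => L_gerst_eq_sum_contribution e b k l ξ η g x, fun α β h x => ?_⟩
  have hx : (x : V) ∈ fixedSpace K V α ⊓ fixedSpace K V β := by rw [h]; exact x.2
  rw [contribution, L32, L2_component_gerst_TPart b e hξ hη hx.1 hx.2]
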